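/- Let $M$ be a smooth manifold of dimension $2n+1$ with a Riemannian metric $g=\langle\cdot,\cdot\rangle$, let $\alpha$ be a contact form on $M$ with Reeb vector field $R$, and let $\xi=\ker\alpha$, oriented by $d\alpha$ when $n=1$. We use $d\alpha(u,v)=u\cdot\alpha(v)-v\cdot\alpha(u)-\alpha([u,v])$. Assume that $R$ is orthogonal to $\xi$; set $\rho=\|R\|$ and $n_\xi=R/\rho$. Let $J$ be an almost complex structure on $\xi$ compatible with $d\alpha|_\xi$, i.e. $d\alpha(Ju,Jv)=d\alpha(u,v)$, and $d\alpha(v,Jv)>0$ for $v\neq0$. Let $W=\mathbb R_+\times M$ be the symplectization of $(M,\xi)$, trivialized by $\alpha$, with coordinate $t$ on $\mathbb R_+$. Extend $J$ to $TW$ by $J\partial_t=n_\xi$, $Jn_\xi=-\partial_t$, and extend $g$ to $W$ by $g+dt\otimes dt$. Let $f:M\to\mathbb R$ be smooth, let $S=f^{-1}(c)$ be a regular level set, and regard $f$ also as a function on $W$. Put $\Sigma=\mathbb R_+\times S\subset W$ and $\mathcal C=T\Sigma\cap J(T\Sigma)$, and let $L(u,v)=-d(df\circ J)(u,Jv)$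 be the Levi form of $\Sigma$. Let $\nabla^2 f$ denote the Riemannian Hessian of $f$. (1) Suppose that $(M,\alpha,g,J)$ is a CR-compatible metric structure: $\|R\|=1$; there is a constant $\theta'>0$ with $g(u,v)=\frac1{\theta'}d\alpha(u,Jv)$ for $u,v\in\xi$; and $J([Jv,w]+[v,Jw])=[Jv,Jw]-[v,w]$ for all sections $v,w$ of $\xi$. Then for every $v\in\mathcal C$ $$L(v,v)=\nabla^2f(v,v)+\nabla^2f(Jv,Jv).$$ (2) Suppose that $\dim M=3$ and that $J$ is $g$-isometric on $\xi$. (So $g$ is weakly compatible with $\xi$, and $J$ is the rotation by $\pi/2$ in $\xi$.) Then for every $v\in\mathcal C$ $$\begin{aligned}L(v,v)&=\nabla^2f(v,v)+\nabla^2f(Jv,Jv)-\|\nabla f\|\,\langle n_S,(\nabla\ln\rho)^\xi-2H\,n_\xi\rangle\,\|v\|^2\\&=\nabla^2f(v,v)+\nabla^2f(Jv,Jv)-\|\nabla f\|\,\langle n_S,\nabla\ln\rho-(\nabla\ln\theta')^\perp\rangle\,\|v\|^2.\end{aligned}$$ Here $n_S=\nabla f/\|\nabla f\|$ is the unit normal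 to $S$; $w^\perp=\langle w,n_\xi\rangle n_\xi$ and $w^\xi=w-w^\perp$. The function $H=\frac12\operatorname{tr}I\!I$ is the mean curvature of $\xi$, where $I\!I(u,v)=\frac12\langle\nabla_uv+\nabla_vu,n_\xi\rangle$ for $u,v$ tangent to $\xi$. The function $\theta'=-\langle[u,v],n_\xi\rangle$, for any oriented orthonormal frame $u,v$ of $\xi$, is the instantaneous rotation of $\xi$. -/

import Mathlib

open Bundle FiberBundle VectorField
open scoped Manifold ContDiff

noncomputable section

/-! ### Riemannian and exterior calculus on a manifold -/

section Calculus

variable {E : Type*} [NormedAddCommGroup E] [NormedSpace ℝ E]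
  {H : Type*} [TopologicalSpace H] (I : ModelWithCorners ℝ E H)
  {M : Type*} [TopologicalSpace M] [ChartedSpace H M] [IsManifold I 1 M]

/-- The exterior derivative of a 1-form `β`, with the convention
`dβ(X, Y) = X · β(Y) - Y · β(X) - β([X, Y])`. The formula is tensorial in `X`, `Y`; at the point `x`
it is evaluated on the extensions of `u`, `v` that are constant in the preferred trivialization
of the tangent bundle at `x`. -/
def extDerivOne (β : Π x : M, TangentSpace I x →L[ℝ] ℝ) (x : M) (u v : TangentSpace I x) : ℝ :=
  mvfderiv I (fun y => β y (extend E v y)) x u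
    - mvfderiv I (fun y => β y (extend E u y)) x v
    - β x (mlieBracket I (extend E u) (extend E v) x)

/-- The right-hand side of the Koszul formula for `2 ⟨∇_X Y, Z⟩` at the point `x`. -/
def koszul (g : Π x : M, TangentSpace I x →L[ℝ] TangentSpace I x →L[ℝ] ℝ)
    (X Y Z : Π x : M, TangentSpace I x) (x : M) : ℝ :=
  mvfderiv I (fun y => g y (Y y) (Z y)) x (X x)
    + mvfderiv I (fun y => g y (X y) (Z y)) x (Y x)
    - mvfderiv I (fun y => g y (X y) (Y y)) x (Z x)
    + g x (mlieBracket I X Y x) (Z x)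
    + g x (mlieBracket I Z X x) (Y x)
    + g x (mlieBracket I Z Y x) (X x)

/-- The Levi-Civita covariant derivative `∇_X Y` at `x` of the metric `g`: the (unique) tangent
vector `z` at `x` which satisfies the Koszul formula `2 ⟨z, Z⟩ = koszul X Y Z` for all vector fields
`Z` that are differentiable at `x`. -/
def leviCivita (g : Π x : M, TangentSpace I x →L[ℝ] TangentSpace I x →L[ℝ] ℝ)
    (X Y : Π x : M, TangentSpace I x) (x : M) : TangentSpace I x :=
  Classical.epsilon fun z : TangentSpace I x =>
    ∀ Z : Π y : M, TangentSpace I y,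
      MDifferentiableAt I I.tangent (fun y => (TotalSpace.mk' E y (Z y) : TangentBundle I M)) x →
        2 * g x z (Z x) = koszul I g X Y Z x

/-- The gradient of `f` at `x`: the (unique) tangent vector dual to `df_x`. -/
def riemGradient (g : Π x : M, TangentSpace I x →L[ℝ] TangentSpace I x →L[ℝ] ℝ)
    (f : M → ℝ) (x : M) : TangentSpace I x :=
  Classical.epsilon fun z : TangentSpace I x => ∀ w, g x z w = mvfderiv I f x w

/-- The Riemannian Hessian `∇²f(X, Y) = X · (df(Y)) - df(∇_X Y)`, a tensor, evaluated at tangent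
vectors `u`, `v` at `x` through extensions of them. -/
def hessian (g : Π x : M, TangentSpace I x →L[ℝ] TangentSpace I x →L[ℝ] ℝ)
    (f : M → ℝ) (x : M) (u v : TangentSpace I x) : ℝ :=
  mvfderiv I (fun y => mvfderiv I f y (extend E v y)) x u
    - mvfderiv I f x (leviCivita I g (extend E u) (extend E v) x)

/-- The norm of a tangent vector: `‖v‖ = √(g(v, v))`. -/
def gNorm (g : Π x : M, TangentSpace I x →L[ℝ] TangentSpace I x →L[ℝ] ℝ)
    (x : M) (v : TangentSpace I x) : ℝ :=
  √(g x v v)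

/-- The unit normal `n_S = ∇f / ‖∇f‖` at `x` to the level set of `f` through `x`. -/
def levelNormal (g : Π x : M, TangentSpace I x →L[ℝ] TangentSpace I x →L[ℝ] ℝ)
    (f : M → ℝ) (x : M) : TangentSpace I x :=
  (gNorm I g x (riemGradient I g f x))⁻¹ • riemGradient I g f x

end Calculus

/-! ### Contact forms, Reeb fields and compatible metrics -/

section Contact

variable {E : Type*} [NormedAddCommGroup E] [NormedSpace ℝ E]
  {H : Type*} [TopologicalSpace H] (I : ModelWithCorners ℝ E H)
  {M : Type*} [TopologicalSpace M] [ChartedSpace H M] [IsManifold I 1 M]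

/-- `α` is a (smooth) contact form: it vanishes nowhere and `dα` is nondegenerate on
`ξ = ker α`. On a manifold of dimension `2n+1` this says that `α ∧ (dα)^n` vanishes nowhere. -/
structure IsContactForm (α : Π x : M, TangentSpace I x →L[ℝ] ℝ) : Prop where
  smooth : ContMDiff I (I.prod 𝓘(ℝ, E →L[ℝ] ℝ)) ∞ (fun x => TotalSpace.mk' (E →L[ℝ] ℝ) x (α x))
  ne_zero : ∀ x, α x ≠ 0
  nondegenerate : ∀ x u, α x u = 0 →
    (∀ v, α x v = 0 → extDerivOne I α x u v = 0) → u = 0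

/-- `R` is the Reeb vector field of `α`. -/
structure IsReebField (α : Π x : M, TangentSpace I x →L[ℝ] ℝ)
    (R : Π x : M, TangentSpace I x) : Prop where
  smooth : ContMDiff I I.tangent ∞ (fun x => (TotalSpace.mk' E x (R x) : TangentBundle I M))
  apply_self : ∀ x, α x (R x) = 1
  contract : ∀ x v, extDerivOne I α x (R x) v = 0

/-- `J` is an almost complex structure on `ξ = ker α` which is compatible with `dα` on `ξ`,
encoded as its unique extension to an endomorphism of `TM` that vanishes on the Reeb field. -/
structure IsCompatibleComplexStructure (α : Π x : M, TangentSpace I x →L[ℝ] ℝ)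
    (R : Π x : M, TangentSpace I x)
    (J : Π x : M, TangentSpace I x →L[ℝ] TangentSpace I x) : Prop where
  smooth : ContMDiff I (I.prod 𝓘(ℝ, E →L[ℝ] E)) ∞ (fun x => TotalSpace.mk' (E →L[ℝ] E) x (J x))
  reeb : ∀ x, J x (R x) = 0
  mem : ∀ x v, α x (J x v) = 0
  sq : ∀ x v, α x v = 0 → J x (J x v) = -v
  pos : ∀ x v, α x v = 0 → v ≠ 0 → 0 < extDerivOne I α x v (J x v)
  invariant : ∀ x u v, α x u = 0 → α x v = 0 →
    extDerivOne I α x (J x u) (J x v) = extDerivOne I α x u v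

/-- `g` is weakly compatible with `ξ = ker α` in dimension three, with `α` the contact form
implicated in this: the Reeb field is orthogonal to `ξ`. `J` is the associated almost complex
structure on `ξ`: the `g`-isometric one that is compatible with `dα` (the rotation by `π/2` in `ξ`,
where `ξ` is oriented by `dα`). -/
structure IsWeaklyCompatible (g : Π x : M, TangentSpace I x →L[ℝ] TangentSpace I x →L[ℝ] ℝ)
    (α : Π x : M, TangentSpace I x →L[ℝ] ℝ) (R : Π x : M, TangentSpace I x)
    (J : Π x : M, TangentSpace I x →L[ℝ] TangentSpace I x) : Prop where
  contact : IsContactForm I α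
  reebField : IsReebField I α R
  orthogonal : ∀ x v, α x v = 0 → g x (R x) v = 0
  complex : IsCompatibleComplexStructure I α R J
  isometric : ∀ x u v, α x u = 0 → α x v = 0 → g x (J x u) (J x v) = g x u v

/-- The integrability condition `J([JV, W] + [V, JW]) = [JV, JW] - [V, W]` for all smooth sections
`V`, `W` of `ξ = ker α`. -/
def IsIntegrableCR (α : Π x : M, TangentSpace I x →L[ℝ] ℝ)
    (J : Π x : M, TangentSpace I x →L[ℝ] TangentSpace I x) : Prop :=
  ∀ V W : Π x : M, TangentSpace I x,
    ContMDiff I I.tangent ∞ (fun x => (TotalSpace.mk' E x (V x) : TangentBundle I M)) →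
    ContMDiff I I.tangent ∞ (fun x => (TotalSpace.mk' E x (W x) : TangentBundle I M)) →
    (∀ x, α x (V x) = 0) → (∀ x, α x (W x) = 0) → ∀ x,
      J x (mlieBracket I (fun y => J y (V y)) W x + mlieBracket I V (fun y => J y (W y)) x)
        = mlieBracket I (fun y => J y (V y)) (fun y => J y (W y)) x - mlieBracket I V W x

/-- `(M, α, g, J)` is a CR-compatible metric structure: the Reeb field `R` is the unit normal to
`ξ = ker α`, `J` is compatible with `dα`, `g(u, v) = (1/θ') dα(u, Jv)` on `ξ` for a positive
constant `θ'`, and `J` is an integrable CR-structure on `ξ`. -/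
structure IsCRCompatible (g : Π x : M, TangentSpace I x →L[ℝ] TangentSpace I x →L[ℝ] ℝ)
    (α : Π x : M, TangentSpace I x →L[ℝ] ℝ) (R : Π x : M, TangentSpace I x)
    (J : Π x : M, TangentSpace I x →L[ℝ] TangentSpace I x) : Prop where
  contact : IsContactForm I α
  reebField : IsReebField I α R
  unit : ∀ x, g x (R x) (R x) = 1
  orthogonal : ∀ x v, α x v = 0 → g x (R x) v = 0
  complex : IsCompatibleComplexStructure I α R J
  metric : ∃ θ : ℝ, 0 < θ ∧ ∀ x u v, α x u = 0 → α x v = 0 →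
    g x u v = θ⁻¹ * extDerivOne I α x u (J x v)
  integrable : IsIntegrableCR I α J

variable (g : Π x : M, TangentSpace I x →L[ℝ] TangentSpace I x →L[ℝ] ℝ)
  (α : Π x : M, TangentSpace I x →L[ℝ] ℝ) (R : Π x : M, TangentSpace I x)

/-- The function `ρ = ‖R‖`. -/
def reebNorm (x : M) : ℝ := gNorm I g x (R x)

/-- `n = R / ‖R‖`, the oriented unit normal to `ξ`. -/
def unitReeb (x : M) : TangentSpace I x := (reebNorm I g R x)⁻¹ • R x

/-- The component `w^⊥` of `w` in the direction of `n`. -/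
def normalPart (x : M) (w : TangentSpace I x) : TangentSpace I x :=
  g x w (unitReeb I g R x) • unitReeb I g R x

/-- The component `w^ξ = w - ⟨w, n⟩ n` of `w` in `ξ`. -/
def contactPart (x : M) (w : TangentSpace I x) : TangentSpace I x :=
  w - normalPart I g R x w

/-- An extension of `u ∈ ξ_x` to a local vector field tangent to `ξ`. -/
def contactExtend {x : M} (u : TangentSpace I x) : Π y : M, TangentSpace I y :=
  fun y => contactPart I g R y (extend E u y)

/-- A positively oriented (with respect to `dα`) orthonormal basis of `ξ_x`, for a
three-dimensional `M`. -/
def contactFrame (x : M) : TangentSpace I x × TangentSpace I x :=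
  Classical.epsilon fun e : TangentSpace I x × TangentSpace I x =>
    α x e.1 = 0 ∧ α x e.2 = 0 ∧ g x e.1 e.1 = 1 ∧ g x e.2 e.2 = 1 ∧ g x e.1 e.2 = 0 ∧
      0 < extDerivOne I α x e.1 e.2

/-- The instantaneous rotation `θ' = -⟨[u, v], n⟩` of `ξ` (dimension three), where `u`, `v` are
vector fields tangent to `ξ` that form an oriented orthonormal basis of `ξ_x` at the point `x`. -/
def contactRotation (x : M) : ℝ :=
  -g x (mlieBracket I (contactExtend I g R (contactFrame I g α x).1)
      (contactExtend I g R (contactFrame I g α x).2) x) (unitReeb I g R x)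

/-- The second fundamental form `II(u, v) = ½ ⟨∇_u v + ∇_v u, n⟩` of `ξ`, where `u`, `v` are
extended to vector fields tangent to `ξ`. -/
def secondFundamentalForm (x : M) (u v : TangentSpace I x) : ℝ :=
  (1 / 2) * g x (leviCivita I g (contactExtend I g R u) (contactExtend I g R v) x
    + leviCivita I g (contactExtend I g R v) (contactExtend I g R u) x) (unitReeb I g R x)

/-- The mean curvature `H = ½ tr II` of `ξ` (dimension three). -/
def meanCurvature (x : M) : ℝ :=
  (1 / 2) * (secondFundamentalForm I g R x (contactFrame I g α x).1 (contactFrame I g α x).1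
    + secondFundamentalForm I g R x (contactFrame I g α x).2 (contactFrame I g α x).2)

end Contact

/-! ### The symplectization and the Levi form -/

/-- The half-line `ℝ₊` as an open submanifold of `ℝ`. -/
abbrev PosHalfLine : TopologicalSpace.Opens ℝ := ⟨Set.Ioi (0 : ℝ), isOpen_Ioi⟩

/-- The symplectization `W = ℝ₊ × M`, trivialized by the contact form. Its tangent space at
`(t, x)` is `ℝ × T_xM`, where `∂_t = (1, 0)`. -/
abbrev Symplectization (M : Type*) : Type _ := PosHalfLine × M

section Symplectization

variable {E : Type*} [NormedAddCommGroup E] [NormedSpace ℝ E]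
  {H : Type*} [TopologicalSpace H] (I : ModelWithCorners ℝ E H)
  {M : Type*} [TopologicalSpace M] [ChartedSpace H M] [IsManifold I 1 M]

/-- The projection `T_wW → T_xM` for `w = (t, x)`. -/
def projM (w : Symplectization M) :
    TangentSpace (𝓘(ℝ, ℝ).prod I) w →L[ℝ] TangentSpace I w.2 :=
  ContinuousLinearMap.snd ℝ ℝ E

/-- The 1-form `dt` on `W`. -/
def dtForm (w : Symplectization M) : TangentSpace (𝓘(ℝ, ℝ).prod I) w →L[ℝ] ℝ :=
  ContinuousLinearMap.fst ℝ ℝ E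

/-- The inclusion `T_xM → T_wW` as vectors tangent to `{t} × M`. -/
def inclM (w : Symplectization M) :
    TangentSpace I w.2 →L[ℝ] TangentSpace (𝓘(ℝ, ℝ).prod I) w :=
  ContinuousLinearMap.inr ℝ ℝ E

/-- The vector field `∂_t` on `W`. -/
def partialT (w : Symplectization M) : TangentSpace (𝓘(ℝ, ℝ).prod I) w :=
  ((1, 0) : ℝ × E)

variable (g : Π x : M, TangentSpace I x →L[ℝ] TangentSpace I x →L[ℝ] ℝ)

/-- The metric `g + dt ⊗ dt` on `W`. -/
def sympMetric (w : Symplectization M) :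
    TangentSpace (𝓘(ℝ, ℝ).prod I) w →L[ℝ] TangentSpace (𝓘(ℝ, ℝ).prod I) w →L[ℝ] ℝ :=
  ((ContinuousLinearMap.precomp ℝ (projM I w)).comp ((g w.2).comp (projM I w))) + (dtForm I w).smulRight (dtForm I w)

variable (α : Π x : M, TangentSpace I x →L[ℝ] ℝ) (R : Π x : M, TangentSpace I x)
  (J : Π x : M, TangentSpace I x →L[ℝ] TangentSpace I x)

/-- The almost complex structure on `W` which extends `J` on `ξ` by `J ∂_t = n` and
`J n = -∂_t`; since `u = u^ξ + ρ α(u) n` with `ρ = ‖R‖`, it maps `u + b ∂_t`, `u ∈ TM`, to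
`J u^ξ + b n - ρ α(u) ∂_t`. -/
def sympJ (w : Symplectization M) :
    TangentSpace (𝓘(ℝ, ℝ).prod I) w →L[ℝ] TangentSpace (𝓘(ℝ, ℝ).prod I) w :=
  (inclM I w).comp ((J w.2).comp (projM I w))
    + (dtForm I w).smulRight (inclM I w (unitReeb I g R w.2))
    - (reebNorm I g R w.2 • (α w.2).comp (projM I w)).smulRight (partialT I w)

/-- The Levi form `L(u, v) = -d(df ∘ J)(u, Jv)`, where `f : M → ℝ` is regarded as a function
on `W`. -/
def leviForm (f : M → ℝ) (w : Symplectization M) (u v : TangentSpace (𝓘(ℝ, ℝ).prod I) w) : ℝ :=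
  -extDerivOne (𝓘(ℝ, ℝ).prod I)
    (fun z : Symplectization M =>
      (mvfderiv (𝓘(ℝ, ℝ).prod I) (fun p : Symplectization M => f p.2) z).comp
        (sympJ I g α R J z))
    w u (sympJ I g α R J w v)

/-- The tangent space at `w` of the regular level set of `f` (regarded as a function on `W`)
through `w`. -/
def tangentLevel (f : M → ℝ) (w : Symplectization M) :
    Submodule ℝ (TangentSpace (𝓘(ℝ, ℝ).prod I) w) :=
  LinearMap.ker
    (mvfderiv (𝓘(ℝ, ℝ).prod I) (fun p : Symplectization M => f p.2) w :
      TangentSpace (𝓘(ℝ, ℝ).prod I) w →ₗ[ℝ] ℝ)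

/-- The complex tangencies `𝒞 = TΣ ∩ J(TΣ)`. -/
def complexTangencies (f : M → ℝ) (w : Symplectization M) :
    Submodule ℝ (TangentSpace (𝓘(ℝ, ℝ).prod I) w) :=
  tangentLevel I f w ⊓
    (tangentLevel I f w).map
      (sympJ I g α R J w : TangentSpace (𝓘(ℝ, ℝ).prod I) w →ₗ[ℝ] TangentSpace (𝓘(ℝ, ℝ).prod I) w)

/-- The hypersurface `Σ = ℝ₊ × S` for the level set `S = f⁻¹(c)`. -/
def sympHypersurface (f : M → ℝ) (c : ℝ) : Set (Symplectization M) :=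
  {w | f w.2 = c}

/-- The Hessian `∇²f`, with respect to `g + dt ⊗ dt`, of `f : M → ℝ` regarded as a function
on `W`. -/
def sympHessian (f : M → ℝ) (w : Symplectization M) (u v : TangentSpace (𝓘(ℝ, ℝ).prod I) w) : ℝ :=
  hessian (𝓘(ℝ, ℝ).prod I) (sympMetric I g) (fun p : Symplectization M => f p.2) w u v

/-- The norm on `TW` given by `g + dt ⊗ dt`. -/
def sympNorm (w : Symplectization M) (v : TangentSpace (𝓘(ℝ, ℝ).prod I) w) : ℝ :=
  gNorm (𝓘(ℝ, ℝ).prod I) (sympMetric I g) w v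

end Symplectization

end

/-!
Let `ρ = ‖R‖`, `n = R / ρ`, `η = ⟨n, ·⟩ = ρ α`, and let `Φ = ⟨J·, ·⟩` be the fundamental 2-form,
where `J` is extended by `J n = 0`. Both parts of the theorem rest on one computation on `M`, valid
whenever `R` is orthogonal to `ξ`, `J` is isometric on `ξ` and `dα = μ Φ` for a positive function
`μ`. In the first part `ρ = 1` and `μ` is a constant; in the second part `ξ` is a plane field, so
`dα` and `Φ` are proportional on it, and `μ = θ' / ρ`
(`IsWeaklyCompatible.extDerivOne_eq_contactRotation`).

For a vector `v = u + b ∂_t` of `W` with `a = η(u)`, extend the component of `u` in `ξ` to a section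
`X` of `ξ`, and put `U = X + a n`, `P = J X + b n`; thus `U = u` at the point, and `P` is the
component of `J v` in `TM`. Since nothing depends on `t`, and `J U = J X`, `J P = -X`, one finds
`L(v, v) = U(Uf) + P(Pf) + df(J [U, P])` (`leviForm_eq`), and the Hessian terms are
`U(Uf) - df(∇_U U)` and `P(Pf) - df(∇_P P)` (`sympHessian_eq`). So the quantity to be computed is
`⟨∇_U U + ∇_P P + J [U, P], Z⟩` with `Z = ∇f`. The Koszul formula turns it into exterior derivatives
(`IsWeaklyCompatible.koszul_add_koszul`):
`⟨∇_U U + ∇_P P + J [U, P], Z⟩ = a dη(U, Z) + b dη(P, Z) - dΦ(U, P, Z)`.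
Now `dη = dρ ∧ α + ρ dα`, and `d(μ Φ) = d(dα) = 0` gives `μ dΦ = -dμ ∧ Φ`
(`IsWeaklyCompatible.fundamentalFormDeriv_eq`). Hence the difference between `L(v, v)` and the sum
of the Hessians involves only the logarithmic derivatives of `ρ` and `μ`
(`leviForm_eq_hessian_add`), which vanish in the first part.

In dimension three, `∇f` is expanded in the orthogonal frame `X, J X, n`
(`IsWeaklyCompatible.inner_self_smul`); `v ∈ 𝒞` gives `df(X) = -a df(n)` and `df(J X) = -b df(n)`
for its components, and the difference becomes
`-‖v‖² (d ln ρ(∇f) - (d ln ρ(n) + d ln μ(n)) df(n))`. Here `ρ μ = θ'`, and the identity above for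
`a = b = 0`, `Z = n` says that the trace `2H` of the second fundamental form is `d ln μ(n)`
(`IsWeaklyCompatible.two_mul_meanCurvature`), which gives both forms of the correction term.
-/

noncomputable section

/-! ### Tensoriality of the exterior derivative and of the Koszul formula -/

section Tensoriality

variable {E : Type*} [NormedAddCommGroup E] [NormedSpace ℝ E]
  {H : Type*} [TopologicalSpace H] {I : ModelWithCorners ℝ E H}
  {M : Type*} [TopologicalSpace M] [ChartedSpace H M]

lemma mvfderiv_mul_apply {f h : M → ℝ} {x : M} (hf : MDiffAt f x) (hh : MDiffAt h x)
    (v : TangentSpace I x) :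
    mvfderiv I (fun y => f y * h y) x v = f x * mvfderiv I h x v + h x * mvfderiv I f x v := by
  rw [mvfderiv_fun_mul hf hh]; simp

lemma mvfderiv_add_apply {f h : M → ℝ} {x : M} (hf : MDiffAt f x) (hh : MDiffAt h x)
    (v : TangentSpace I x) :
    mvfderiv I (fun y => f y + h y) x v = mvfderiv I f x v + mvfderiv I h x v := by
  rw [mvfderiv_fun_add hf hh]; simp

lemma mvfderiv_sub_apply {f h : M → ℝ} {x : M} (hf : MDiffAt f x) (hh : MDiffAt h x)
    (v : TangentSpace I x) :
    mvfderiv I (fun y => f y - h y) x v = mvfderiv I f x v - mvfderiv I h x v := by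
  rw [mvfderiv_fun_sub hf hh]; simp

lemma mvfderiv_const_mul_apply (c : ℝ) {f : M → ℝ} {x : M} (hf : MDiffAt f x)
    (v : TangentSpace I x) :
    mvfderiv I (fun y => c * f y) x v = c * mvfderiv I f x v := by
  rw [mvfderiv_mul_apply mdifferentiableAt_const hf, mvfderiv_const]; simp

lemma Filter.EventuallyEq.mvfderiv_eq {f h : M → ℝ} {x : M} (hfh : f =ᶠ[nhds x] h) :
    mvfderiv I f x = mvfderiv I h x := by
  unfold mvfderiv
  ext v
  have := hfh.mfderiv_eq (I := I) (I' := 𝓘(ℝ, ℝ))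
  simp only [ContinuousLinearMap.comp_apply]
  rw [this]; rfl

variable [IsManifold I 2 M] [FiniteDimensional ℝ E]

/-- A 1-form is differentiable at `x` if it takes differentiable vector fields to differentiable
functions. -/
def FormDifferentiableAt (I : ModelWithCorners ℝ E H) {M : Type*} [TopologicalSpace M]
    [ChartedSpace H M] [IsManifold I 1 M] (β : Π x : M, TangentSpace I x →L[ℝ] ℝ) (x : M) : Prop :=
  ∀ Y : Π x : M, TangentSpace I x, MDiffAt (T% Y) x → MDiffAt (fun y => β y (Y y)) x

/-- A family of bilinear forms is differentiable at `x` if it takes pairs of differentiable vector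
fields to differentiable functions. -/
def MetricDifferentiableAt (I : ModelWithCorners ℝ E H) {M : Type*} [TopologicalSpace M]
    [ChartedSpace H M] [IsManifold I 1 M]
    (g : Π x : M, TangentSpace I x →L[ℝ] TangentSpace I x →L[ℝ] ℝ) (x : M) : Prop :=
  ∀ X Y : Π x : M, TangentSpace I x, MDiffAt (T% X) x → MDiffAt (T% Y) x →
    MDiffAt (fun y => g y (X y) (Y y)) x

/-- The exterior derivative may be evaluated on arbitrary differentiable vector fields. -/
lemma extDerivOne_eq {β : Π x : M, TangentSpace I x →L[ℝ] ℝ} {x : M}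
    (hβ : FormDifferentiableAt I β x) {X Y : Π x : M, TangentSpace I x}
    (hX : MDiffAt (T% X) x) (hY : MDiffAt (T% Y) x) :
    extDerivOne I β x (X x) (Y x) = mvfderiv I (fun y => β y (Y y)) x (X x)
      - mvfderiv I (fun y => β y (X y)) x (Y x) - β x (mlieBracket I X Y x) := by
  have key := TensorialAt.pointwise₂ (I := I) (F := E) (F' := E) (x := x)
    (Φ := fun X Y : Π x : M, TangentSpace I x => mvfderiv I (fun y => β y (Y y)) x (X x)
      - mvfderiv I (fun y => β y (X y)) x (Y x) - β x (mlieBracket I X Y x))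
    (σ := extend E (X x)) (σ' := X) (τ := extend E (Y x)) (τ' := Y)
    ?_ ?_ (mdifferentiableAt_extend ..) hX (mdifferentiableAt_extend ..) hY (by simp) (by simp)
  · simpa [extDerivOne] using key
  · intro Y hY
    refine ⟨fun {h X} hh hX => ?_, fun {X X'} hX hX' => ?_⟩
    · simp only [Pi.smul_apply', map_smul, smul_eq_mul]
      rw [mvfderiv_mul_apply hh (hβ _ hX), mlieBracket_smul_left hh hX]
      simp
      ring
    · simp only [Pi.add_apply, map_add]
      rw [mvfderiv_add_apply (hβ _ hX) (hβ _ hX'), mlieBracket_add_left hX hX']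
      simp
      ring
  · intro X hX
    refine ⟨fun {h Y} hh hY => ?_, fun {Y Y'} hY hY' => ?_⟩
    · simp only [Pi.smul_apply', map_smul, smul_eq_mul]
      rw [mvfderiv_mul_apply hh (hβ _ hY), mlieBracket_smul_right hh hY]
      simp
      ring
    · simp only [Pi.add_apply, map_add]
      rw [mvfderiv_add_apply (hβ _ hY) (hβ _ hY'), mlieBracket_add_right hY hY']
      simp
      ring

lemma koszul_tensorialAt {g : Π x : M, TangentSpace I x →L[ℝ] TangentSpace I x →L[ℝ] ℝ} {x : M}
    (hg : MetricDifferentiableAt I g x) (hs : ∀ y u v, g y u v = g y v u)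
    {X Y : Π x : M, TangentSpace I x} (hX : MDiffAt (T% X) x) (hY : MDiffAt (T% Y) x) :
    TensorialAt I E (fun Z => koszul I g X Y Z x) x := by
  refine ⟨fun {h Z} hh hZ => ?_, fun {Z Z'} hZ hZ' => ?_⟩
  · simp only [koszul, Pi.smul_apply', map_smul, smul_eq_mul]
    rw [mvfderiv_mul_apply hh (hg _ _ hX hZ), mvfderiv_mul_apply hh (hg _ _ hY hZ),
      mlieBracket_smul_left hh hZ, mlieBracket_smul_left hh hZ]
    simp only [map_add, map_smul, map_neg, add_apply, smul_eq_mul,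
      smul_apply, neg_smul, neg_apply]
    rw [hs x (Z x) (X x), hs x (Z x) (Y x)]
    ring
  · simp only [koszul, Pi.add_apply, map_add]
    rw [mvfderiv_add_apply (hg _ _ hX hZ) (hg _ _ hX hZ'),
      mvfderiv_add_apply (hg _ _ hY hZ) (hg _ _ hY hZ'),
      mlieBracket_add_left hZ hZ', mlieBracket_add_left hZ hZ']
    simp only [map_add, add_apply]
    ring

/-- The covariant derivative `(∇_X β)(Y) = X · β(Y) - β(∇_X Y)` of a 1-form `β` at the point `x`,
where `Z` is a vector field that represents `β` there and `⟨∇_X Y, Z⟩` is expanded by the Koszul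
formula. -/
def covDerivForm (I : ModelWithCorners ℝ E H) {M : Type*} [TopologicalSpace M]
    [ChartedSpace H M] [IsManifold I 1 M]
    (g : Π x : M, TangentSpace I x →L[ℝ] TangentSpace I x →L[ℝ] ℝ)
    (β : Π x : M, TangentSpace I x →L[ℝ] ℝ) (Z X Y : Π x : M, TangentSpace I x) (x : M) : ℝ :=
  mvfderiv I (fun y => β y (Y y)) x (X x) - (1 / 2) * koszul I g X Y Z x

/-- `(∇_X β)(Y)` depends only on the values of `X` and `Y` at the point. -/
lemma covDerivForm_congr {g : Π x : M, TangentSpace I x →L[ℝ] TangentSpace I x →L[ℝ] ℝ} {x : M}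
    (hg : MetricDifferentiableAt I g x) (hs : ∀ y u v, g y u v = g y v u)
    {β : Π x : M, TangentSpace I x →L[ℝ] ℝ} (hβ : FormDifferentiableAt I β x)
    {Z : Π x : M, TangentSpace I x} (hZ : MDiffAt (T% Z) x) (hβZ : ∀ v, g x (Z x) v = β x v)
    {X X' Y Y' : Π x : M, TangentSpace I x} (hX : MDiffAt (T% X) x) (hX' : MDiffAt (T% X') x)
    (hY : MDiffAt (T% Y) x) (hY' : MDiffAt (T% Y') x) (hXX' : X x = X' x) (hYY' : Y x = Y' x) :
    covDerivForm I g β Z X Y x = covDerivForm I g β Z X' Y' x := by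
  refine TensorialAt.pointwise₂ (I := I) (F := E) (F' := E) (x := x)
    (Φ := fun X Y : Π x : M, TangentSpace I x => covDerivForm I g β Z X Y x)
    ?_ ?_ hX hX' hY hY' hXX' hYY'
  · intro Y hY
    refine ⟨fun {h X} hh hX => ?_, fun {X X'} hX hX' => ?_⟩
    · simp only [covDerivForm, koszul, Pi.smul_apply', map_smul, smul_eq_mul,
        smul_apply]
      rw [mvfderiv_mul_apply hh (hg _ _ hX hZ), mvfderiv_mul_apply hh (hg _ _ hX hY),
        mlieBracket_smul_left hh hX, mlieBracket_smul_right hh hX]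
      simp only [map_add, map_smul, map_neg, add_apply, smul_eq_mul,
        smul_apply, neg_smul, neg_apply]
      ring
    · simp only [covDerivForm, koszul, Pi.add_apply, map_add, add_apply]
      rw [mvfderiv_add_apply (hg _ _ hX hZ) (hg _ _ hX' hZ),
        mvfderiv_add_apply (hg _ _ hX hY) (hg _ _ hX' hY),
        mlieBracket_add_left hX hX', mlieBracket_add_right hX hX']
      simp only [map_add, add_apply]
      ring
  · intro X hX
    refine ⟨fun {h Y} hh hY => ?_, fun {Y Y'} hY hY' => ?_⟩
    · simp only [covDerivForm, koszul, Pi.smul_apply', map_smul, smul_eq_mul,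
        smul_apply]
      rw [mvfderiv_mul_apply hh (hβ _ hY), mvfderiv_mul_apply hh (hg _ _ hY hZ),
        mvfderiv_mul_apply hh (hg _ _ hX hY),
        mlieBracket_smul_right hh hY, mlieBracket_smul_right hh hY]
      simp only [map_add, map_smul, add_apply, smul_eq_mul,
        smul_apply]
      rw [← hβZ, hs x (Z x) (Y x), hs x (X x) (Y x)]
      ring
    · simp only [covDerivForm, koszul, Pi.add_apply, map_add, add_apply]
      rw [mvfderiv_add_apply (hβ _ hY) (hβ _ hY'),
        mvfderiv_add_apply (hg _ _ hY hZ) (hg _ _ hY' hZ),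
        mvfderiv_add_apply (hg _ _ hX hY) (hg _ _ hX hY'),
        mlieBracket_add_right hY hY', mlieBracket_add_right hY hY']
      simp only [map_add, add_apply]
      ring

omit [IsManifold I 2 M] in
/-- A positive definite form on a tangent space represents every linear functional. -/
lemma exists_forall_apply_eq {x : M} {B : TangentSpace I x →L[ℝ] TangentSpace I x →L[ℝ] ℝ}
    (hpos : ∀ v, v ≠ 0 → 0 < B v v) (l : TangentSpace I x →ₗ[ℝ] ℝ) : ∃ z, ∀ w, B z w = l w := by
  have hfd : FiniteDimensional ℝ (TangentSpace I x) := inferInstanceAs (FiniteDimensional ℝ E)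
  let B' : TangentSpace I x →ₗ[ℝ] (TangentSpace I x →ₗ[ℝ] ℝ) :=
    { toFun := fun v => (B v : TangentSpace I x →ₗ[ℝ] ℝ)
      map_add' := fun v w => by ext; simp
      map_smul' := fun c w => by ext; simp }
  have hinj : Function.Injective B' := by
    rw [← LinearMap.ker_eq_bot, LinearMap.ker_eq_bot']
    intro v hv
    by_contra hne
    exact (hpos v hne).ne' (LinearMap.congr_fun hv v)
  have hsurj : Function.Surjective B' := by
    rw [← LinearMap.injective_iff_surjective_of_finrank_eq_finrank]
    · exact hinj
    · exact (Subspace.dual_finrank_eq (K := ℝ) (V := TangentSpace I x)).symm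
  obtain ⟨z, hz⟩ := hsurj l
  exact ⟨z, fun w => LinearMap.congr_fun hz w⟩

/-- `leviCivita` satisfies the Koszul formula: the right-hand side is tensorial in `Z`, so a
representing vector exists. -/
lemma two_mul_leviCivita {g : Π x : M, TangentSpace I x →L[ℝ] TangentSpace I x →L[ℝ] ℝ} {x : M}
    (hg : MetricDifferentiableAt I g x) (hs : ∀ y u v, g y u v = g y v u)
    (hpos : ∀ v, v ≠ 0 → 0 < g x v v)
    {X Y Z : Π x : M, TangentSpace I x} (hX : MDiffAt (T% X) x) (hY : MDiffAt (T% Y) x)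
    (hZ : MDiffAt (T% Z) x) :
    2 * g x (leviCivita I g X Y x) (Z x) = koszul I g X Y Z x := by
  have hT := koszul_tensorialAt hg hs hX hY
  obtain ⟨z, hz⟩ := exists_forall_apply_eq (B := g x) hpos
    ((1 / 2 : ℝ) • (TensorialAt.mkHom _ x hT : TangentSpace I x →ₗ[ℝ] ℝ))
  have hex : ∃ z : TangentSpace I x, ∀ Z : Π y : M, TangentSpace I y,
      MDifferentiableAt I I.tangent (fun y => (TotalSpace.mk' E y (Z y) : TangentBundle I M)) x →
        2 * g x z (Z x) = koszul I g X Y Z x := by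
    refine ⟨z, fun Z hZ => ?_⟩
    have h1 : g x z (Z x) = (1 / 2 : ℝ) * TensorialAt.mkHom _ x hT (Z x) := hz (Z x)
    rw [h1, TensorialAt.mkHom_apply hT hZ]
    ring
  exact Classical.epsilon_spec hex Z hZ

end Tensoriality

/-! ### Vector fields that are constant in a chart, and brackets acting on functions -/

section Charts

variable {E : Type*} [NormedAddCommGroup E] [NormedSpace ℝ E]
  {H : Type*} [TopologicalSpace H] {I : ModelWithCorners ℝ E H}
  {M : Type*} [TopologicalSpace M] [ChartedSpace H M]

section

variable [IsManifold I 1 M]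

lemma extend_eq_symmL {x y : M} (u : TangentSpace I x) (hy : y ∈ (chartAt H x).source) :
    extend E u y = (trivializationAt E (TangentSpace I) x).symmL ℝ y u := by
  have h1 : (trivializationAt E (TangentSpace I) x ⟨x, u⟩).2 = u := by
    have := TangentBundle.continuousLinearMapAt_trivializationAt (I := I) (𝕜 := ℝ)
      (mem_chart_source H x)
    rw [mfderiv_extChartAt_self] at this
    have h2 := congrArg (fun L => L u) this
    simpa [Trivialization.continuousLinearMapAt_apply, Trivialization.linearMapAt_apply] using! h2
  simp only [extend]
  rw [h1]
  exact (Trivialization.symmL_apply (hb := hy) ..).symm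

lemma extend_eq_mfderivWithin {x y : M} (u : TangentSpace I x) (hy : y ∈ (chartAt H x).source) :
    extend E u y = mfderivWithin 𝓘(ℝ, E) I (extChartAt I x).symm (Set.range I)
      (extChartAt I x y) u := by
  rw [extend_eq_symmL u hy, TangentBundle.symmL_trivializationAt hy]
  rfl

/-- The vector fields `extend E u` are constant in the chart at `x`. -/
lemma mlieBracket_extend_self {x : M} (u v : TangentSpace I x) :
    mlieBracket I (extend E u) (extend E v) x = 0 := by
  have key : ∀ u : TangentSpace I x,
      mpullbackWithin 𝓘(ℝ, E) I (extChartAt I x).symm (extend E u) (Set.range I)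
        =ᶠ[nhdsWithin (extChartAt I x x) (Set.range I)] fun _ => u := by
    intro u
    filter_upwards [extChartAt_target_mem_nhdsWithin x] with z hz
    have hy : (extChartAt I x).symm z ∈ (chartAt H x).source := by
      rw [← extChartAt_source I]; exact (extChartAt I x).map_target hz
    have hinv := isInvertible_mfderivWithin_extChartAt_symm hz
    rw [mpullbackWithin_apply, extend_eq_mfderivWithin u hy, (extChartAt I x).right_inv hz]
    exact hinv.inverse_apply_self u
  rw [← mlieBracketWithin_univ, mlieBracketWithin_apply]
  simp only [Set.preimage_univ, Set.univ_inter]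
  rw [(key u).lieBracketWithin_vectorField_eq_of_mem (key v) (Set.mem_range_self _)]
  have hconst : ∀ (u v : E) (s : Set E) (z : E),
      lieBracketWithin ℝ (fun _ : E => u) (fun _ : E => v) s z = 0 := by
    intro u v s z
    simp [lieBracketWithin]
  exact (congrArg _ (hconst u v _ _)).trans (map_zero _)

end

lemma mvfderiv_eq_fderiv [IsManifold I 1 M] [I.Boundaryless] {h : M → ℝ} {x : M}
    (hh : DifferentiableAt ℝ (h ∘ (extChartAt I x).symm) (extChartAt I x x))
    (v : TangentSpace I x) :
    mvfderiv I h x v = fderiv ℝ (h ∘ (extChartAt I x).symm) (extChartAt I x x) v := by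
  have h1 : h =ᶠ[nhds x] (h ∘ (extChartAt I x).symm) ∘ extChartAt I x := by
    filter_upwards [extChartAt_source_mem_nhds (I := I) x] with y hy
    exact (congrArg h ((extChartAt I x).left_inv hy)).symm
  rw [h1.mvfderiv_eq, mvfderiv_comp_apply x hh.mdifferentiableAt
    (mdifferentiableAt_extChartAt (mem_chart_source H x)), mfderiv_extChartAt_self]
  simp [mvfderiv, mfderiv_eq_fderiv]
  rfl

/-- `[X, Y] f = X (Y f) - Y (X f)`. -/
lemma mvfderiv_mlieBracket [IsManifold I 2 M] [I.Boundaryless] [CompleteSpace E] {f : M → ℝ} {x : M}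
    (hf : CMDiffAt 2 f x) {X Y : Π x : M, TangentSpace I x}
    (hX : MDiffAt (T% X) x) (hY : MDiffAt (T% Y) x) :
    mvfderiv I f x (mlieBracket I X Y x) = mvfderiv I (fun y => mvfderiv I f y (Y y)) x (X x)
      - mvfderiv I (fun y => mvfderiv I f y (X y)) x (Y x) := by
  set φ := extChartAt I x with hφ
  set F : E → ℝ := f ∘ φ.symm with hF
  have hrange : Set.range I = Set.univ := I.range_eq_univ
  -- `pb X` is `X` in the chart at `x`; there the bracket is `DY(X) - DX(Y)`, and the claim reduces to
  -- the symmetry of the second derivative of `F`.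
  let pb : (Π x : M, TangentSpace I x) → E → E := fun X =>
    mpullbackWithin 𝓘(ℝ, E) I φ.symm X (Set.range I)
  have hpb : ∀ X : Π x : M, TangentSpace I x, MDiffAt (T% X) x →
      DifferentiableAt ℝ (pb X) (φ x) := by
    intro X hX
    have : DifferentiableWithinAt ℝ (pb X) (φ.symm ⁻¹' Set.univ ∩ Set.range I) (φ x) :=
      MDifferentiableWithinAt.differentiableWithinAt_mpullbackWithin_vectorField
        (mdifferentiableWithinAt_univ.2 hX)
    rwa [Set.preimage_univ, Set.univ_inter, hrange, differentiableWithinAt_univ] at this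
  have hpbx : ∀ X : Π x : M, TangentSpace I x, pb X (φ x) = X x := by
    intro X
    have hA : ∀ (A : E →L[ℝ] E) (v : E), A = ContinuousLinearMap.id ℝ E → A.inverse v = v := by
      rintro A v rfl
      rw [ContinuousLinearMap.inverse_id]
      rfl
    refine (hA _ (X (φ.symm (φ x))) mfderivWithin_range_extChartAt_symm).trans ?_
    exact congrArg (fun y => (X y : E)) (extChartAt_to_inv x)
  have hFx : ContDiffAt ℝ 2 F (φ x) := by
    have := (contMDiffAt_iff_source (x := x)).1 hf
    rw [hrange, contMDiffWithinAt_univ, contMDiffAt_iff_contDiffAt] at this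
    exact this
  have hloc : ∀ X : Π x : M, TangentSpace I x,
      (fun y => mvfderiv I f y (X y)) ∘ φ.symm =ᶠ[nhds (φ x)] fun z => fderiv ℝ F z (pb X z) := by
    intro X
    have hev : ∀ᶠ y in nhds x, MDiffAt f y := by
      filter_upwards [(contMDiffAt_iff_contMDiffAt_nhds (by simp)).1 hf] with y hy
      exact hy.mdifferentiableAt (by simp)
    have hev' : ∀ᶠ z in nhds (φ x), MDiffAt f (φ.symm z) := by
      have hc : Filter.Tendsto φ.symm (nhds (φ x)) (nhds x) := by
        have := continuousAt_extChartAt_symm (I := I) x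
        rw [ContinuousAt, extChartAt_to_inv] at this
        exact this
      exact hc.eventually hev
    filter_upwards [extChartAt_target_mem_nhds (I := I) x, hev'] with z hz hfz
    have hinv := isInvertible_mfderivWithin_extChartAt_symm hz
    have hs : MDiffAt φ.symm z := by
      have := mdifferentiableWithinAt_extChartAt_symm (I := I) hz
      rwa [hrange, mdifferentiableWithinAt_univ] at this
    have h1 : fderiv ℝ F z = (mvfderiv I f (φ.symm z)).comp (mfderiv 𝓘(ℝ, E) I φ.symm z) := by
      rw [← mvfderiv_comp z hfz hs]
      simp only [mvfderiv, mfderiv_eq_fderiv]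
      rfl
    rw [h1]
    simp only [Function.comp_apply, pb, mpullbackWithin_apply]
    have h2 : mfderiv 𝓘(ℝ, E) I φ.symm z = mfderivWithin 𝓘(ℝ, E) I φ.symm (Set.range I) z := by
      rw [hrange, mfderivWithin_univ]
    rw [h2]
    change _ = mvfderiv I f (φ.symm z) (mfderivWithin 𝓘(ℝ, E) I φ.symm (Set.range I) z
      ((mfderivWithin 𝓘(ℝ, E) I φ.symm (Set.range I) z).inverse (X (φ.symm z))))
    rw [hinv.self_apply_inverse]
  have hfd : DifferentiableAt ℝ (fderiv ℝ F) (φ x) :=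
    (hFx.fderiv_right (m := 1) (by norm_num)).differentiableAt (by simp)
  -- `X (Y f) = D²F(X, Y) + DF(DY(X))` in the chart.
  have hsec : ∀ X Y : Π x : M, TangentSpace I x, MDiffAt (T% Y) x →
      mvfderiv I (fun y => mvfderiv I f y (Y y)) x (X x)
        = fderiv ℝ (fderiv ℝ F) (φ x) (X x) (Y x)
          + fderiv ℝ F (φ x) (fderiv ℝ (pb Y) (φ x) (X x)) := by
    intro X Y hY
    have hd : DifferentiableAt ℝ (fun z => fderiv ℝ F z (pb Y z)) (φ x) := hfd.clm_apply (hpb Y hY)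
    rw [mvfderiv_eq_fderiv ((hloc Y).differentiableAt_iff.2 hd), (hloc Y).fderiv_eq,
      fderiv_clm_apply hfd (hpb Y hY), hpbx]
    change fderiv ℝ F (φ x) (fderiv ℝ (pb Y) (φ x) (X x))
      + fderiv ℝ (fderiv ℝ F) (φ x) (X x) (Y x) = _
    rw [add_comm]
  rw [hsec X Y hY, hsec Y X hX]
  have hbr : mlieBracket I X Y x = lieBracket ℝ (pb X) (pb Y) (φ x) := by
    rw [← mlieBracketWithin_univ, mlieBracketWithin_apply, mfderiv_extChartAt_self]
    change (ContinuousLinearMap.id ℝ E).inverse (lieBracketWithin ℝ (pb X) (pb Y)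
      (φ.symm ⁻¹' Set.univ ∩ Set.range I) (φ x)) = _
    rw [ContinuousLinearMap.inverse_id, Set.preimage_univ, Set.univ_inter, hrange,
      lieBracketWithin_univ]
    rfl
  have hFf : ∀ v : E, mvfderiv I f x v = fderiv ℝ F (φ x) v := fun v =>
    mvfderiv_eq_fderiv (hFx.differentiableAt (by simp)) v
  rw [hbr, hFf]
  simp only [lieBracket, hpbx, map_sub]
  have hsymm : fderiv ℝ (fderiv ℝ F) (φ x) (X x) (Y x) = fderiv ℝ (fderiv ℝ F) (φ x) (Y x) (X x) :=
    hFx.isSymmSndFDerivAt (by simp) _ _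
  rw [hsymm]
  ring

lemma formDifferentiableAt_mvfderiv [IsManifold I 2 M] {f : M → ℝ} {x : M} (hf : CMDiffAt 2 f x) :
    FormDifferentiableAt I (mvfderiv I f) x := by
  intro Y hY
  have h1 := (hf.mfderiv_const (m := 1) (by norm_num)).mdifferentiableAt (by simp)
  have h2 := h1.clm_apply_of_inCoordinates (b₁ := id) (b₂ := f) hY
    (hf.mdifferentiableAt (by simp))
  have h3 := ((contMDiff_snd_tangentBundle_modelSpace ℝ 𝓘(ℝ, ℝ) (n := 1)).mdifferentiable
    (by simp) _).comp x h2
  exact h3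

end Charts

/-! ### Smooth forms and metrics; `d ∘ d = 0` -/

section Smoothness

variable {E : Type*} [NormedAddCommGroup E] [NormedSpace ℝ E]
  {H : Type*} [TopologicalSpace H] {I : ModelWithCorners ℝ E H}
  {M : Type*} [TopologicalSpace M] [ChartedSpace H M] [IsManifold I ∞ M]
  {n : ℕ∞ω} {x : M}

lemma ContMDiffAt.form_apply {α : Π x : M, TangentSpace I x →L[ℝ] ℝ}
    (hα : ContMDiffAt I (I.prod 𝓘(ℝ, E →L[ℝ] ℝ)) n (fun x => TotalSpace.mk' (E →L[ℝ] ℝ) x (α x)) x)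
    {Y : Π x : M, TangentSpace I x} (hY : CMDiffAt n (T% Y) x) :
    CMDiffAt n (fun y => α y (Y y)) x := by
  have h : ContMDiffAt I (I.prod 𝓘(ℝ, ℝ)) n
      (fun y => TotalSpace.mk' ℝ (E := Bundle.Trivial M ℝ) y (α y (Y y))) x :=
    ContMDiffAt.clm_bundle_apply (F₁ := E) (F₂ := ℝ) hα hY
  simp only [contMDiffAt_totalSpace] at h
  exact h.2

lemma ContMDiffAt.metric_apply {g : Π x : M, TangentSpace I x →L[ℝ] TangentSpace I x →L[ℝ] ℝ}
    (hg : ContMDiffAt I (I.prod 𝓘(ℝ, E →L[ℝ] E →L[ℝ] ℝ)) n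
      (fun x => TotalSpace.mk' (E →L[ℝ] E →L[ℝ] ℝ) x (g x)) x)
    {X Y : Π x : M, TangentSpace I x} (hX : CMDiffAt n (T% X) x) (hY : CMDiffAt n (T% Y) x) :
    CMDiffAt n (fun y => g y (X y) (Y y)) x := by
  have h : ContMDiffAt I (I.prod 𝓘(ℝ, ℝ)) n
      (fun y => TotalSpace.mk' ℝ (E := Bundle.Trivial M ℝ) y (g y (X y) (Y y))) x :=
    ContMDiffAt.clm_bundle_apply₂ (F₁ := E) (F₂ := E) hg hX hY
  simp only [contMDiffAt_totalSpace] at h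
  exact h.2

lemma formDifferentiableAt_of_contMDiffAt {α : Π x : M, TangentSpace I x →L[ℝ] ℝ}
    (hα : ContMDiffAt I (I.prod 𝓘(ℝ, E →L[ℝ] ℝ)) n (fun x => TotalSpace.mk' (E →L[ℝ] ℝ) x (α x)) x)
    (hn : n ≠ 0) : FormDifferentiableAt I α x := by
  intro Y hY
  have h : MDifferentiableAt I (I.prod 𝓘(ℝ, ℝ))
      (fun y => TotalSpace.mk' ℝ (E := Bundle.Trivial M ℝ) y (α y (Y y))) x :=
    MDifferentiableAt.clm_bundle_apply (F₁ := E) (F₂ := ℝ) (hα.mdifferentiableAt hn) hY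
  simp only [mdifferentiableAt_totalSpace] at h
  exact h.2

lemma metricDifferentiableAt_of_contMDiffAt
    {g : Π x : M, TangentSpace I x →L[ℝ] TangentSpace I x →L[ℝ] ℝ}
    (hg : ContMDiffAt I (I.prod 𝓘(ℝ, E →L[ℝ] E →L[ℝ] ℝ)) n
      (fun x => TotalSpace.mk' (E →L[ℝ] E →L[ℝ] ℝ) x (g x)) x)
    (hn : n ≠ 0) : MetricDifferentiableAt I g x := by
  intro X Y hX hY
  have h : MDifferentiableAt I (I.prod 𝓘(ℝ, ℝ))
      (fun y => TotalSpace.mk' ℝ (E := Bundle.Trivial M ℝ) y (g y (X y) (Y y))) x :=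
    MDifferentiableAt.clm_bundle_apply₂ (F₁ := E) (F₂ := E) (hg.mdifferentiableAt hn) hX hY
  simp only [mdifferentiableAt_totalSpace] at h
  exact h.2

variable [I.Boundaryless] [FiniteDimensional ℝ E]

/-- `d(dα) = 0`, evaluated on vector fields. -/
lemma extDerivOne_closed {α : Π x : M, TangentSpace I x →L[ℝ] ℝ}
    (hα : ContMDiff I (I.prod 𝓘(ℝ, E →L[ℝ] ℝ)) ∞ (fun x => TotalSpace.mk' (E →L[ℝ] ℝ) x (α x)))
    {X Y Z : Π x : M, TangentSpace I x} (hX : CMDiffAt 2 (T% X) x) (hY : CMDiffAt 2 (T% Y) x)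
    (hZ : CMDiffAt 2 (T% Z) x) :
    mvfderiv I (fun y => extDerivOne I α y (Y y) (Z y)) x (X x)
      + mvfderiv I (fun y => extDerivOne I α y (Z y) (X y)) x (Y x)
      + mvfderiv I (fun y => extDerivOne I α y (X y) (Y y)) x (Z x)
      - extDerivOne I α x (mlieBracket I X Y x) (Z x)
      - extDerivOne I α x (mlieBracket I Y Z x) (X x)
      - extDerivOne I α x (mlieBracket I Z X x) (Y x) = 0 := by
  have : IsManifold I (minSmoothness ℝ 2) M := by
    rw [minSmoothness_of_isRCLikeNormedField]; infer_instance
  have : IsManifold I (minSmoothness ℝ 3) M := by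
    rw [minSmoothness_of_isRCLikeNormedField]; infer_instance
  have : IsManifold I (((2 : ℕ∞) : ℕ∞ω) + 1) M := IsManifold.of_le (n := ∞) (mod_cast le_top)
  have hform : ∀ y, FormDifferentiableAt I α y := fun y =>
    formDifferentiableAt_of_contMDiffAt hα.contMDiffAt (by simp)
  have hbr : ∀ {X Y : Π x : M, TangentSpace I x}, CMDiffAt 2 (T% X) x → CMDiffAt 2 (T% Y) x →
      MDiffAt (T% (mlieBracket I X Y)) x := fun hX hY =>
    (ContMDiffAt.mlieBracket_vectorField (m := 1) (n := 2) hX hY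
      (by simp; norm_num)).mdifferentiableAt (by simp)
  have hd : ∀ {X : Π x : M, TangentSpace I x}, CMDiffAt 2 (T% X) x → MDiffAt (T% X) x :=
    fun hX => hX.mdifferentiableAt (by simp)
  -- `Y · α(Z)` is differentiable.
  have hdd : ∀ {Y Z : Π x : M, TangentSpace I x}, CMDiffAt 2 (T% Y) x → CMDiffAt 2 (T% Z) x →
      MDiffAt (fun y => mvfderiv I (fun y => α y (Z y)) y (Y y)) x := fun {Y Z} hY hZ =>
    formDifferentiableAt_mvfderiv (ContMDiffAt.form_apply
      (hα.contMDiffAt.of_le (WithTop.coe_le_coe.2 le_top)) hZ) Y (hd hY)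
  have hev : ∀ {X : Π x : M, TangentSpace I x}, CMDiffAt 2 (T% X) x →
      ∀ᶠ y in nhds x, MDiffAt (T% X) y := by
    intro X hX
    filter_upwards [(contMDiffAt_iff_contMDiffAt_nhds (by simp)).1 hX] with y hy
    exact hy.mdifferentiableAt (by simp)
  -- The derivative of `dα(Y, Z)` along `X`, with `dα` expanded near the point.
  have hone : ∀ {X Y Z : Π x : M, TangentSpace I x}, CMDiffAt 2 (T% X) x → CMDiffAt 2 (T% Y) x →
      CMDiffAt 2 (T% Z) x → mvfderiv I (fun y => extDerivOne I α y (Y y) (Z y)) x (X x)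
      = mvfderiv I (fun y => mvfderiv I (fun y => α y (Z y)) y (Y y)) x (X x)
        - mvfderiv I (fun y => mvfderiv I (fun y => α y (Y y)) y (Z y)) x (X x)
        - mvfderiv I (fun y => α y (mlieBracket I Y Z y)) x (X x) := by
    intro X Y Z hX hY hZ
    have h1 : (fun y => extDerivOne I α y (Y y) (Z y)) =ᶠ[nhds x] fun y =>
        mvfderiv I (fun y => α y (Z y)) y (Y y) - mvfderiv I (fun y => α y (Y y)) y (Z y)
        - α y (mlieBracket I Y Z y) := by
      filter_upwards [hev hY, hev hZ] with y hYy hZy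
      exact extDerivOne_eq (hform y) hYy hZy
    have h2 : MDiffAt (fun y => mvfderiv I (fun y => α y (Z y)) y (Y y)
        - mvfderiv I (fun y => α y (Y y)) y (Z y)) x :=
      MDifferentiableAt.sub (hdd hY hZ) (hdd hZ hY)
    rw [h1.mvfderiv_eq, mvfderiv_sub_apply h2 (hform x _ (hbr hY hZ)),
      mvfderiv_sub_apply (hdd hY hZ) (hdd hZ hY)]
  have hcomm : ∀ {X Y Z : Π x : M, TangentSpace I x}, CMDiffAt 2 (T% X) x → CMDiffAt 2 (T% Y) x →
      CMDiffAt 2 (T% Z) x → mvfderiv I (fun y => α y (Z y)) x (mlieBracket I X Y x)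
      = mvfderiv I (fun y => mvfderiv I (fun y => α y (Z y)) y (Y y)) x (X x)
        - mvfderiv I (fun y => mvfderiv I (fun y => α y (Z y)) y (X y)) x (Y x) :=
    fun hX hY hZ => mvfderiv_mlieBracket
      (ContMDiffAt.form_apply (hα.contMDiffAt.of_le (WithTop.coe_le_coe.2 le_top)) hZ)
      (hd hX) (hd hY)
  -- Second derivatives cancel by `[X, Y] h = X (Y h) - Y (X h)`, double brackets by Jacobi.
  have hjac : mlieBracket I (mlieBracket I X Y) Z x + mlieBracket I (mlieBracket I Y Z) X x
      + mlieBracket I (mlieBracket I Z X) Y x = 0 := by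
    have h := leibniz_identity_mlieBracket_apply (I := I) (x := x) (U := X) (V := Y) (W := Z)
      (by simpa using hX) (by simpa using hY) (by simpa using hZ)
    have h1 : mlieBracket I X (mlieBracket I Y Z) x = - mlieBracket I (mlieBracket I Y Z) X x :=
      mlieBracket_swap_apply
    have h2 : mlieBracket I Y (mlieBracket I X Z) x = mlieBracket I (mlieBracket I Z X) Y x := by
      rw [mlieBracket_swap_apply, mlieBracket_swap (V := X) (W := Z)]
      have := mlieBracket_const_smul_left (I := I) (c := (-1 : ℝ)) (V := mlieBracket I Z X) (W := Y)
        (x := x) (hbr hZ hX)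
      simp only [neg_smul, one_smul] at this
      rw [this, neg_neg]
    rw [h1, h2] at h
    rw [add_assoc, add_comm (mlieBracket I (mlieBracket I Y Z) X x), ← add_assoc, ← h,
      neg_add_cancel]
  have hjacα := congrArg (α x) hjac
  simp only [map_add, map_zero] at hjacα
  rw [hone hX hY hZ, hone hY hZ hX, hone hZ hX hY, extDerivOne_eq (hform x) (hbr hX hY) (hd hZ),
    extDerivOne_eq (hform x) (hbr hY hZ) (hd hX), extDerivOne_eq (hform x) (hbr hZ hX) (hd hY),
    hcomm hX hY hZ, hcomm hY hZ hX, hcomm hZ hX hY]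
  linarith

end Smoothness

/-! ### Linear algebra and smoothness of the Reeb field, the metric and `J` -/

section WeaklyCompatible

variable {E : Type*} [NormedAddCommGroup E] [NormedSpace ℝ E]
  {H : Type*} [TopologicalSpace H] {I : ModelWithCorners ℝ E H}
  {M : Type*} [TopologicalSpace M] [ChartedSpace H M] [IsManifold I ∞ M]
  {G : ContMDiffRiemannianMetric I ∞ E (fun x : M => TangentSpace I x)}
  {α : Π x : M, TangentSpace I x →L[ℝ] ℝ} {R : Π x : M, TangentSpace I x}
  {J : Π x : M, TangentSpace I x →L[ℝ] TangentSpace I x} {x : M}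

lemma metric_contMDiff (G : ContMDiffRiemannianMetric I ∞ E (fun x : M => TangentSpace I x)) :
    ContMDiff I (I.prod 𝓘(ℝ, E →L[ℝ] E →L[ℝ] ℝ)) ∞
      (fun x => TotalSpace.mk' (E →L[ℝ] E →L[ℝ] ℝ) x (G.inner x)) :=
  G.contMDiff

lemma metricDifferentiableAt (G : ContMDiffRiemannianMetric I ∞ E (fun x : M => TangentSpace I x))
    (x : M) : MetricDifferentiableAt I G.inner x :=
  metricDifferentiableAt_of_contMDiffAt (metric_contMDiff G x) (by simp)

namespace IsWeaklyCompatible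

variable (h : IsWeaklyCompatible I G.inner α R J)
include h

lemma reeb_ne_zero (x : M) : R x ≠ 0 := by
  intro h0
  have := h.reebField.apply_self x
  rw [h0, map_zero] at this
  exact zero_ne_one this

lemma reebNorm_pos (x : M) : 0 < reebNorm I G.inner R x :=
  Real.sqrt_pos.2 (G.pos x _ (h.reeb_ne_zero x))

lemma reebNorm_sq (x : M) : reebNorm I G.inner R x ^ 2 = G.inner x (R x) (R x) :=
  Real.sq_sqrt (G.pos x _ (h.reeb_ne_zero x)).le

lemma inner_reeb (x : M) (w : TangentSpace I x) :
    G.inner x (R x) w = reebNorm I G.inner R x ^ 2 * α x w := by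
  have h1 := h.orthogonal x (w - α x w • R x) (by simp [h.reebField.apply_self])
  rw [map_sub, map_smul, ← h.reebNorm_sq, smul_eq_mul] at h1
  linarith

lemma inner_unitReeb (x : M) (w : TangentSpace I x) :
    G.inner x (unitReeb I G.inner R x) w = reebNorm I G.inner R x * α x w := by
  have := (h.reebNorm_pos x).ne'
  rw [unitReeb, map_smul, smul_apply, h.inner_reeb, smul_eq_mul]
  field_simp

lemma apply_unitReeb (x : M) :
    α x (unitReeb I G.inner R x) = (reebNorm I G.inner R x)⁻¹ := by
  rw [unitReeb, map_smul, h.reebField.apply_self, smul_eq_mul, mul_one]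

lemma inner_unitReeb_self (x : M) :
    G.inner x (unitReeb I G.inner R x) (unitReeb I G.inner R x) = 1 := by
  rw [h.inner_unitReeb, h.apply_unitReeb, mul_inv_cancel₀ (h.reebNorm_pos x).ne']

lemma complex_unitReeb (x : M) : J x (unitReeb I G.inner R x) = 0 := by
  rw [unitReeb, map_smul, h.complex.reeb, smul_zero]

lemma normalPart_eq (x : M) (w : TangentSpace I x) :
    normalPart I G.inner R x w = α x w • R x := by
  rw [normalPart, G.symm, h.inner_unitReeb, unitReeb, smul_smul, mul_right_comm,
    mul_inv_cancel₀ (h.reebNorm_pos x).ne', one_mul]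

lemma contactPart_eq (x : M) (w : TangentSpace I x) :
    contactPart I G.inner R x w = w - α x w • R x := by
  rw [contactPart, h.normalPart_eq]

lemma apply_contactPart (x : M) (w : TangentSpace I x) :
    α x (contactPart I G.inner R x w) = 0 := by
  simp [h.contactPart_eq, h.reebField.apply_self]

lemma contactPart_of_mem {w : TangentSpace I x} (hw : α x w = 0) :
    contactPart I G.inner R x w = w := by
  simp [h.contactPart_eq, hw]

lemma contactPart_add_unitReeb (x : M) (w : TangentSpace I x) :
    contactPart I G.inner R x w
      + (reebNorm I G.inner R x * α x w) • unitReeb I G.inner R x = w := by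
  rw [h.contactPart_eq, unitReeb, smul_smul, mul_right_comm,
    mul_inv_cancel₀ (h.reebNorm_pos x).ne', one_mul, sub_add_cancel]

lemma complex_contactPart (x : M) (w : TangentSpace I x) :
    J x (contactPart I G.inner R x w) = J x w := by
  rw [h.contactPart_eq, map_sub, map_smul, h.complex.reeb, smul_zero, sub_zero]

lemma complex_complex (x : M) (w : TangentSpace I x) :
    J x (J x w) = -contactPart I G.inner R x w := by
  rw [← h.complex_contactPart x w, h.complex.sq _ _ (h.apply_contactPart x w)]

lemma inner_unitReeb_of_mem {w : TangentSpace I x} (hw : α x w = 0) :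
    G.inner x (unitReeb I G.inner R x) w = 0 := by
  rw [h.inner_unitReeb, hw, mul_zero]

/-- The fundamental 2-form `⟨J·, ·⟩` is skew-symmetric on `TM`, since `J R = 0` and `R ⊥ ξ`. -/
lemma inner_complex_skew (x : M) (v w : TangentSpace I x) :
    G.inner x (J x v) w = -G.inner x (J x w) v := by
  have key : ∀ v w : TangentSpace I x,
      G.inner x (J x v) w = G.inner x (J x v) (contactPart I G.inner R x w) := by
    intro v w
    rw [h.contactPart_eq, map_sub, map_smul, G.symm x (J x v) (R x),
      h.orthogonal x _ (h.complex.mem x v), smul_zero, sub_zero]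
  rw [key v w, ← h.isometric x _ _ (h.complex.mem x v) (h.apply_contactPart x w),
    h.complex_contactPart, h.complex_complex, map_neg, neg_apply, G.symm x _ (J x w), ← key w v]

lemma contMDiff_reebNorm : ContMDiff I 𝓘(ℝ, ℝ) ∞ (reebNorm I G.inner R) := by
  intro x
  have h1 : CMDiffAt ∞ (fun y => G.inner y (R y) (R y)) x :=
    ContMDiffAt.metric_apply (metric_contMDiff G x) (h.reebField.smooth x) (h.reebField.smooth x)
  exact (Real.contDiffAt_sqrt (n := ∞)
    (G.pos x _ (h.reeb_ne_zero x)).ne').contMDiffAt.comp x h1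

lemma contMDiff_unitReeb : ContMDiff I I.tangent ∞ (T% (unitReeb I G.inner R)) := by
  intro x
  have h1 : CMDiffAt ∞ (fun y => (reebNorm I G.inner R y)⁻¹) x :=
    (h.contMDiff_reebNorm x).inv₀ (h.reebNorm_pos x).ne'
  exact h1.smul_section (h.reebField.smooth x)

lemma contMDiffAt_complex {Y : Π x : M, TangentSpace I x} {k : ℕ∞ω} (hk : k ≤ ∞)
    (hY : CMDiffAt k (T% Y) x) :
    CMDiffAt k (T% (fun y => J y (Y y))) x :=
  ContMDiffAt.clm_bundle_apply (F₁ := E) (F₂ := E) ((h.complex.smooth x).of_le hk) hY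

lemma mdifferentiableAt_complex {Y : Π x : M, TangentSpace I x} (hY : MDiffAt (T% Y) x) :
    MDiffAt (T% (fun y => J y (Y y))) x :=
  MDifferentiableAt.clm_bundle_apply (F₁ := E) (F₂ := E)
    ((h.complex.smooth x).mdifferentiableAt (by simp)) hY

lemma contMDiffAt_contactExtend (u : TangentSpace I x) :
    CMDiffAt ∞ (T% (contactExtend I G.inner R u)) x := by
  have h1 : contactExtend I G.inner R u = fun y => extend E u y - α y (extend E u y) • R y := by
    funext y; exact h.contactPart_eq y _
  have h2 : CMDiffAt ∞ (T% (extend E u)) x := contMDiffAt_extend I E u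
  rw [h1]
  exact h2.sub_section ((ContMDiffAt.form_apply (h.contact.smooth x) h2).smul_section
    (h.reebField.smooth x))

lemma formDifferentiableAt (x : M) : FormDifferentiableAt I α x :=
  formDifferentiableAt_of_contMDiffAt (h.contact.smooth x) (by simp)

end IsWeaklyCompatible

end WeaklyCompatible

/-! ### The second-order identity for a pair of fields `U`, `P` -/

section SecondOrder

variable {E : Type*} [NormedAddCommGroup E] [NormedSpace ℝ E]
  {H : Type*} [TopologicalSpace H] {I : ModelWithCorners ℝ E H}
  {M : Type*} [TopologicalSpace M] [ChartedSpace H M] [IsManifold I ∞ M]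
  {G : ContMDiffRiemannianMetric I ∞ E (fun x : M => TangentSpace I x)}
  {α : Π x : M, TangentSpace I x →L[ℝ] ℝ} {R : Π x : M, TangentSpace I x}
  {J : Π x : M, TangentSpace I x →L[ℝ] TangentSpace I x} {x : M}

lemma koszul_self (G : ContMDiffRiemannianMetric I ∞ E (fun x : M => TangentSpace I x))
    (U Z : Π x : M, TangentSpace I x) :
    koszul I G.inner U U Z x = 2 * mvfderiv I (fun y => G.inner y (U y) (Z y)) x (U x)
      - mvfderiv I (fun y => G.inner y (U y) (U y)) x (Z x)
      + 2 * G.inner x (mlieBracket I Z U x) (U x) := by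
  simp only [koszul, mlieBracket_self, Pi.zero_apply, map_zero, zero_apply]
  ring

/-- The exterior derivative `dΦ(X, Y, Z)` at `x` of the fundamental 2-form `Φ = ⟨J·, ·⟩`, given by
the invariant formula in the vector fields `X`, `Y`, `Z`. -/
def fundamentalFormDeriv (G : ContMDiffRiemannianMetric I ∞ E (fun x : M => TangentSpace I x))
    (J : Π x : M, TangentSpace I x →L[ℝ] TangentSpace I x)
    (X Y Z : Π x : M, TangentSpace I x) (x : M) : ℝ :=
  mvfderiv I (fun y => G.inner y (J y (Y y)) (Z y)) x (X x)
    + mvfderiv I (fun y => G.inner y (J y (Z y)) (X y)) x (Y x)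
    + mvfderiv I (fun y => G.inner y (J y (X y)) (Y y)) x (Z x)
    - G.inner x (J x (mlieBracket I X Y x)) (Z x)
    - G.inner x (J x (mlieBracket I Y Z x)) (X x)
    - G.inner x (J x (mlieBracket I Z X x)) (Y x)

namespace IsWeaklyCompatible

variable (h : IsWeaklyCompatible I G.inner α R J)
include h

/-- If `dα = μ Φ`, then `μ dΦ = -dμ ∧ Φ`, because `d(dα) = 0`. -/
lemma fundamentalFormDeriv_eq [I.Boundaryless] [FiniteDimensional ℝ E] {μ : M → ℝ}
    (hμ : ∀ᶠ y in nhds x, ∀ v w, extDerivOne I α y v w = μ y * G.inner y (J y v) w)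
    (hμd : MDiffAt μ x) {X Y Z : Π x : M, TangentSpace I x}
    (hX : CMDiffAt 2 (T% X) x) (hY : CMDiffAt 2 (T% Y) x) (hZ : CMDiffAt 2 (T% Z) x) :
    μ x * fundamentalFormDeriv G J X Y Z x =
      - (mvfderiv I μ x (X x) * G.inner x (J x (Y x)) (Z x)
        + mvfderiv I μ x (Y x) * G.inner x (J x (Z x)) (X x)
        + mvfderiv I μ x (Z x) * G.inner x (J x (X x)) (Y x)) := by
  have h0 := extDerivOne_closed h.contact.smooth hX hY hZ
  have h2 : (2 : ℕ∞ω) ≤ ∞ := WithTop.coe_le_coe.2 le_top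
  have hd : ∀ {Y Z : Π x : M, TangentSpace I x}, CMDiffAt 2 (T% Y) x → CMDiffAt 2 (T% Z) x →
      MDiffAt (fun y => G.inner y (J y (Y y)) (Z y)) x := fun hY hZ =>
    metricDifferentiableAt G x _ _ ((h.contMDiffAt_complex h2 hY).mdifferentiableAt (by simp))
      (hZ.mdifferentiableAt (by simp))
  have h1 : ∀ {Y Z : Π x : M, TangentSpace I x}, CMDiffAt 2 (T% Y) x → CMDiffAt 2 (T% Z) x →
      ∀ v, mvfderiv I (fun y => extDerivOne I α y (Y y) (Z y)) x v
        = μ x * mvfderiv I (fun y => G.inner y (J y (Y y)) (Z y)) x v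
          + G.inner x (J x (Y x)) (Z x) * mvfderiv I μ x v := by
    intro Y Z hY hZ v
    have h1 : (fun y => extDerivOne I α y (Y y) (Z y)) =ᶠ[nhds x]
        fun y => μ y * G.inner y (J y (Y y)) (Z y) := by
      filter_upwards [hμ] with y hy
      exact hy _ _
    rw [h1.mvfderiv_eq, mvfderiv_mul_apply hμd (hd hY hZ)]
  rw [h1 hX hY, h1 hY hZ, h1 hZ hX] at h0
  simp only [hμ.self_of_nhds] at h0
  simp only [fundamentalFormDeriv]
  linarith

variable [FiniteDimensional ℝ E]

/-- Let `X` be a section of `ξ` and `U = X + a n`, `P = J X + b n` with constants `a`, `b`. Then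
`⟨∇_U U + ∇_P P + J [U, P], Z⟩ = a dη(U, Z) + b dη(P, Z) - dΦ(U, P, Z)`, where `η = ρ α = ⟨n, ·⟩`.
The reason is that `Φ(P, Z) = a η(Z) - ⟨U, Z⟩`, `Φ(Z, U) = b η(Z) - ⟨P, Z⟩`, and that `Φ(U, P)`,
`⟨U, U⟩`, `⟨P, P⟩` all agree with `⟨X, X⟩` up to constants. -/
lemma koszul_add_koszul {X Z : Π x : M, TangentSpace I x} (a b : ℝ)
    (hXξ : ∀ y, α y (X y) = 0) (hX : MDiffAt (T% X) x) (hZ : MDiffAt (T% Z) x)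
    {U P : Π x : M, TangentSpace I x}
    (hU : U = fun y => X y + a • unitReeb I G.inner R y)
    (hP : P = fun y => J y (X y) + b • unitReeb I G.inner R y) :
    (1 / 2) * koszul I G.inner U U Z x + (1 / 2) * koszul I G.inner P P Z x
        + G.inner x (J x (mlieBracket I U P x)) (Z x) =
      a * extDerivOne I (fun y => reebNorm I G.inner R y • α y) x (U x) (Z x)
      + b * extDerivOne I (fun y => reebNorm I G.inner R y • α y) x (P x) (Z x)
      - fundamentalFormDeriv G J U P Z x := by
  have hm := metricDifferentiableAt G x
  have hn : MDiffAt (T% (unitReeb I G.inner R)) x := (h.contMDiff_unitReeb x).mdifferentiableAt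
    (by simp)
  have hcn : ∀ c : ℝ, MDiffAt (T% (fun y => c • unitReeb I G.inner R y)) x := fun c =>
    (mdifferentiableAt_const (c := c)).smul_section hn
  have hJX := h.mdifferentiableAt_complex hX
  have hUd : MDiffAt (T% U) x := by
    rw [hU]; exact mdifferentiableAt_add_section hX (hcn a)
  have hPd : MDiffAt (T% P) x := by
    rw [hP]; exact mdifferentiableAt_add_section hJX (hcn b)
  have hJU : ∀ y, J y (U y) = J y (X y) := fun y => by
    rw [hU]; simp [h.complex_unitReeb]
  have hJP : ∀ y, J y (P y) = - X y := fun y => by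
    rw [hP]; simp [h.complex_unitReeb, h.complex.sq _ _ (hXξ y)]
  set η : Π x : M, TangentSpace I x →L[ℝ] ℝ := fun y => reebNorm I G.inner R y • α y with hη
  have hηn : ∀ y w, G.inner y (unitReeb I G.inner R y) w = η y w := fun y w => by
    rw [h.inner_unitReeb]; simp [hη]
  have hηd : FormDifferentiableAt I η x := by
    intro Y hY
    have := hm _ _ hn hY
    simp only [hηn] at this
    exact this
  have hηX : ∀ y, η y (X y) = 0 := fun y => by simp [hη, hXξ]
  have hηJX : ∀ y, η y (J y (X y)) = 0 := fun y => by simp [hη, h.complex.mem]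
  have hηnn : ∀ y, η y (unitReeb I G.inner R y) = 1 := fun y => by
    rw [← hηn, h.inner_unitReeb_self]
  have hηU : ∀ y, η y (U y) = a := fun y => by rw [hU]; simp [hηX, hηnn]
  have hηP : ∀ y, η y (P y) = b := fun y => by rw [hP]; simp [hηJX, hηnn]
  have hUin : ∀ y w, G.inner y (X y) w = G.inner y (U y) w - a * η y w := fun y w => by
    rw [hU]; simp [hηn]
  have hPin : ∀ y w, G.inner y (J y (X y)) w = G.inner y (P y) w - b * η y w := fun y w => by
    rw [hP]; simp [hηn]
  have e1 : (fun y => G.inner y (J y (P y)) (Z y)) =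
      fun y => a * η y (Z y) - G.inner y (U y) (Z y) := by
    funext y; rw [hJP, map_neg, neg_apply, hUin]; ring
  have e2 : (fun y => G.inner y (J y (Z y)) (U y)) =
      fun y => b * η y (Z y) - G.inner y (P y) (Z y) := by
    funext y; rw [h.inner_complex_skew, hJU, hPin]; ring
  have hXX : ∀ y, G.inner y (J y (X y)) (J y (X y)) = G.inner y (X y) (X y) := fun y =>
    h.isometric y _ _ (hXξ y) (hXξ y)
  have e3 : (fun y => G.inner y (J y (U y)) (P y)) = fun y => G.inner y (X y) (X y) := by
    funext y
    rw [hJU, G.symm, ← hXX, hPin, hηJX]; ring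
  have e4 : (fun y => G.inner y (U y) (U y)) = fun y => G.inner y (X y) (X y) + a * a := by
    funext y
    have h1 := hUin y (U y)
    have h2 := hUin y (X y)
    rw [hηU] at h1
    rw [hηX, G.symm y (U y)] at h2
    linarith
  have e5 : (fun y => G.inner y (P y) (P y)) = fun y => G.inner y (X y) (X y) + b * b := by
    funext y
    have h1 := hPin y (P y)
    have h2 := hPin y (J y (X y))
    rw [hηP] at h1
    rw [hηJX, G.symm y (P y), hXX] at h2
    linarith
  have hXXd := hm _ _ hX hX
  have hZηd : MDiffAt (fun y => η y (Z y)) x := hηd Z hZ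
  have hcZ : ∀ c : ℝ, MDiffAt (fun y => c * η y (Z y)) x := fun c =>
    MDifferentiableAt.mul mdifferentiableAt_const hZηd
  -- Only the derivatives of `⟨X, X⟩`, `⟨U, Z⟩`, `⟨P, Z⟩`, `η(Z)` and brackets remain.
  rw [koszul_self, koszul_self, extDerivOne_eq hηd hUd hZ, extDerivOne_eq hηd hPd hZ]
  simp only [fundamentalFormDeriv]
  rw [e1, e2, e3, e4, e5, mvfderiv_sub_apply (hcZ a) (hm _ _ hUd hZ),
    mvfderiv_sub_apply (hcZ b) (hm _ _ hPd hZ), mvfderiv_const_mul_apply _ hZηd,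
    mvfderiv_const_mul_apply _ hZηd, mvfderiv_add_apply hXXd mdifferentiableAt_const,
    mvfderiv_add_apply hXXd mdifferentiableAt_const]
  simp only [hηU, hηP, mvfderiv_const, zero_apply]
  rw [h.inner_complex_skew x (mlieBracket I P Z x), h.inner_complex_skew x (mlieBracket I Z U x),
    hJU, hJP, hPin, map_neg, neg_apply, hUin, G.symm x (U x), G.symm x (P x),
    mlieBracket_swap_apply (V := P), mlieBracket_swap_apply (V := U) (W := Z)]
  simp only [map_neg, neg_apply]
  ring

/-- `d(ρ α) = dρ ∧ α + ρ dα`. -/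
lemma extDerivOne_smul {X Y : Π x : M, TangentSpace I x}
    (hX : MDiffAt (T% X) x) (hY : MDiffAt (T% Y) x) :
    extDerivOne I (fun y => reebNorm I G.inner R y • α y) x (X x) (Y x) =
      mvfderiv I (reebNorm I G.inner R) x (X x) * α x (Y x)
      - mvfderiv I (reebNorm I G.inner R) x (Y x) * α x (X x)
      + reebNorm I G.inner R x * extDerivOne I α x (X x) (Y x) := by
  have hα := h.formDifferentiableAt x
  have hρ : MDiffAt (reebNorm I G.inner R) x := (h.contMDiff_reebNorm x).mdifferentiableAt (by simp)
  have hηd : FormDifferentiableAt I (fun y => reebNorm I G.inner R y • α y) x := fun Y hY =>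
    MDifferentiableAt.mul hρ (hα Y hY)
  rw [extDerivOne_eq hηd hX hY, extDerivOne_eq hα hX hY]
  simp only [smul_apply, smul_eq_mul]
  rw [mvfderiv_mul_apply hρ (hα _ hX), mvfderiv_mul_apply hρ (hα _ hY)]
  ring

end IsWeaklyCompatible

end SecondOrder

section SecondOrderProportional

variable {E : Type*} [NormedAddCommGroup E] [NormedSpace ℝ E] [FiniteDimensional ℝ E]
  {H : Type*} [TopologicalSpace H] {I : ModelWithCorners ℝ E H} [I.Boundaryless]
  {M : Type*} [TopologicalSpace M] [ChartedSpace H M] [IsManifold I ∞ M]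
  {G : ContMDiffRiemannianMetric I ∞ E (fun x : M => TangentSpace I x)}
  {α : Π x : M, TangentSpace I x →L[ℝ] ℝ} {R : Π x : M, TangentSpace I x}
  {J : Π x : M, TangentSpace I x →L[ℝ] TangentSpace I x} {x : M}

omit [FiniteDimensional ℝ E] [I.Boundaryless] in
lemma extDerivOne_swap (α : Π x : M, TangentSpace I x →L[ℝ] ℝ) (x : M) (u v : TangentSpace I x) :
    extDerivOne I α x u v = -extDerivOne I α x v u := by
  simp only [extDerivOne]
  rw [mlieBracket_swap_apply, map_neg]
  ring

namespace IsWeaklyCompatible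

variable (h : IsWeaklyCompatible I G.inner α R J)
include h

/-- The identity of `koszul_add_koszul` when `dα = μ Φ` near the point: apart from a term that
cancels once `df(U) = df(P) = 0` for `Z = ∇f`, only logarithmic derivatives of `ρ` and `μ`
remain. -/
lemma koszul_add_koszul_eq {μ : M → ℝ}
    (hμ : ∀ᶠ y in nhds x, ∀ v w, extDerivOne I α y v w = μ y * G.inner y (J y v) w)
    (hμd : MDiffAt μ x) (hμ0 : μ x ≠ 0) {X Z : Π x : M, TangentSpace I x} (a b : ℝ)
    (hXξ : ∀ y, α y (X y) = 0) (hX : CMDiffAt 2 (T% X) x) (hZ : CMDiffAt 2 (T% Z) x)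
    {U P : Π x : M, TangentSpace I x}
    (hU : U = fun y => X y + a • unitReeb I G.inner R y)
    (hP : P = fun y => J y (X y) + b • unitReeb I G.inner R y) :
    (1 / 2) * koszul I G.inner U U Z x + (1 / 2) * koszul I G.inner P P Z x
        + G.inner x (J x (mlieBracket I U P x)) (Z x) =
      (reebNorm I G.inner R x)⁻¹ *
        ((a * mvfderiv I (reebNorm I G.inner R) x (U x)
            + b * mvfderiv I (reebNorm I G.inner R) x (P x))
          * G.inner x (unitReeb I G.inner R x) (Z x)
        - (a ^ 2 + b ^ 2) * mvfderiv I (reebNorm I G.inner R) x (Z x))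
      + reebNorm I G.inner R x * μ x *
        (a * G.inner x (J x (X x)) (Z x) - b * G.inner x (X x) (Z x))
      + (μ x)⁻¹ * (mvfderiv I μ x (Z x) * G.inner x (X x) (X x)
        - mvfderiv I μ x (U x) * G.inner x (X x) (Z x)
        - mvfderiv I μ x (P x) * G.inner x (J x (X x)) (Z x)) := by
  have h2 : (2 : ℕ∞ω) ≤ ∞ := WithTop.coe_le_coe.2 le_top
  have hn : CMDiffAt 2 (T% (unitReeb I G.inner R)) x := (h.contMDiff_unitReeb x).of_le h2
  have hcn : ∀ c : ℝ, CMDiffAt 2 (T% (fun y => c • unitReeb I G.inner R y)) x := fun c =>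
    (contMDiffAt_const (c := c)).smul_section hn
  have hUd : CMDiffAt 2 (T% U) x := by
    rw [hU]; exact hX.add_section (hcn a)
  have hPd : CMDiffAt 2 (T% P) x := by
    rw [hP]; exact (h.contMDiffAt_complex h2 hX).add_section (hcn b)
  rw [h.koszul_add_koszul a b hXξ (hX.mdifferentiableAt (by simp)) (hZ.mdifferentiableAt (by simp))
    hU hP, h.extDerivOne_smul (hUd.mdifferentiableAt (by simp)) (hZ.mdifferentiableAt (by simp)),
    h.extDerivOne_smul (hPd.mdifferentiableAt (by simp)) (hZ.mdifferentiableAt (by simp))]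
  have hF := h.fundamentalFormDeriv_eq hμ hμd hUd hPd hZ
  have hJU : J x (U x) = J x (X x) := by
    rw [hU]; simp [h.complex_unitReeb]
  have hJP : J x (P x) = - X x := by
    rw [hP]; simp [h.complex_unitReeb, h.complex.sq _ _ (hXξ x)]
  have hαU : α x (U x) = (reebNorm I G.inner R x)⁻¹ * a := by
    rw [hU]; simp [hXξ, h.apply_unitReeb, mul_comm]
  have hαP : α x (P x) = (reebNorm I G.inner R x)⁻¹ * b := by
    rw [hP]; simp [h.complex.mem, h.apply_unitReeb, mul_comm]
  have h1 : G.inner x (J x (Z x)) (U x) = - G.inner x (J x (X x)) (Z x) := by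
    rw [h.inner_complex_skew, hJU]
  have h3 : G.inner x (J x (U x)) (P x) = G.inner x (X x) (X x) := by
    rw [h.inner_complex_skew, hJP, map_neg, neg_apply, neg_neg, hU]
    simp [G.symm x (X x) (unitReeb I G.inner R x), h.inner_unitReeb_of_mem (hXξ x)]
  rw [h1, h3, hJP, map_neg, neg_apply] at hF
  rw [hμ.self_of_nhds, hμ.self_of_nhds, hJU, hJP, hαU, hαP, h.inner_unitReeb]
  simp only [map_neg, neg_apply]
  have hρ := (h.reebNorm_pos x).ne'
  have hF' : fundamentalFormDeriv G J U P Z x = (μ x)⁻¹ *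
      (- (mvfderiv I μ x (U x) * -G.inner x (X x) (Z x)
        + mvfderiv I μ x (P x) * -G.inner x (J x (X x)) (Z x)
        + mvfderiv I μ x (Z x) * G.inner x (X x) (X x))) := by
    rw [← hF, ← mul_assoc, inv_mul_cancel₀ hμ0, one_mul]
  rw [hF']
  field_simp
  ring

end IsWeaklyCompatible

end SecondOrderProportional

/-! ### Tangent vectors and the metric of the symplectization -/

section SymplectizationTangent

variable {E : Type*} [NormedAddCommGroup E] [NormedSpace ℝ E]
  {H : Type*} [TopologicalSpace H] {I : ModelWithCorners ℝ E H}
  {M : Type*} [TopologicalSpace M] [ChartedSpace H M] [IsManifold I ∞ M]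

/-- All charts of `ℝ₊` agree, so a change of charts on `ℝ₊ × M` does not affect `∂_t`. -/
lemma tangentCoordChange_symplectization [I.Boundaryless] {w z : Symplectization M}
    (hz : z.2 ∈ (chartAt H w.2).source) (v : ℝ × E) :
    tangentCoordChange (𝓘(ℝ, ℝ).prod I) w z z v = (v.1, tangentCoordChange I w.2 z.2 z.2 v.2) := by
  have h2 : z.2 ∈ (extChartAt I w.2).source ∩ (extChartAt I z.2).source := by
    rw [extChartAt_source, extChartAt_source]
    exact ⟨hz, mem_chart_source H z.2⟩
  have h1 : z.1 ∈ (extChartAt 𝓘(ℝ, ℝ) w.1).source ∩ (extChartAt 𝓘(ℝ, ℝ) z.1).source :=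
    ⟨mem_extChartAt_source (I := 𝓘(ℝ, ℝ)) z.1, mem_extChartAt_source z.1⟩
  have h : z ∈ (extChartAt (𝓘(ℝ, ℝ).prod I) w).source ∩
      (extChartAt (𝓘(ℝ, ℝ).prod I) z).source := by
    rw [extChartAt_prod, extChartAt_prod]
    exact ⟨⟨h1.1, h2.1⟩, ⟨h1.2, h2.2⟩⟩
  have hd := hasFDerivWithinAt_tangentCoordChange h
  have hd1 := hasFDerivWithinAt_tangentCoordChange h1
  have hd2 := hasFDerivWithinAt_tangentCoordChange h2
  rw [ModelWithCorners.range_eq_univ, hasFDerivWithinAt_univ] at hd hd1 hd2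
  have hp := HasFDerivAt.prodMap (p := extChartAt (𝓘(ℝ, ℝ).prod I) w z)
    (by rw [extChartAt_prod]; exact hd1) (by rw [extChartAt_prod]; exact hd2)
  rw [extChartAt_prod] at hp
  rw [extChartAt_prod, extChartAt_prod] at hd
  have huniq := hd.unique hp
  have h3 : tangentCoordChange 𝓘(ℝ, ℝ) w.1 z.1 z.1 v.1 = v.1 :=
    tangentCoordChange_self (I := 𝓘(ℝ, ℝ)) (x := z.1) (mem_extChartAt_source z.1)
  exact (congrArg (fun L => L v) huniq).trans
    (congrArg (fun a : ℝ => (a, tangentCoordChange I w.2 z.2 z.2 v.2)) h3)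

/-- Locally, the extension of `u + b ∂_t` is the extension of `u` on `M` plus `b ∂_t`. -/
lemma extend_symplectization [I.Boundaryless] {w z : Symplectization M}
    (hz : z.2 ∈ (chartAt H w.2).source) (v : TangentSpace (𝓘(ℝ, ℝ).prod I) w) :
    dtForm I z (extend (ℝ × E) v z) = dtForm I w v ∧
      projM I z (extend (ℝ × E) v z) = extend E (projM I w v) z.2 := by
  have hz' : z ∈ (chartAt (ModelProd ℝ H) w).source := by
    rw [prodChartedSpace_chartAt]
    exact ⟨mem_chart_source ℝ z.1, hz⟩
  rw [extend_eq_symmL v hz', extend_eq_symmL _ hz, TangentBundle.symmL_trivializationAt_eq_core hz',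
    TangentBundle.symmL_trivializationAt_eq_core hz]
  have := tangentCoordChange_symplectization (I := I) hz v
  exact ⟨(congrArg Prod.fst this :), (congrArg Prod.snd this :)⟩

lemma eventually_mem_chart_source (w : Symplectization M) :
    ∀ᶠ z in nhds w, z.2 ∈ (chartAt H w.2).source :=
  continuous_snd.continuousAt.eventually (chart_source_mem_nhds H w.2)

omit [IsManifold I ∞ M] in
lemma mvfderiv_comp_snd {h : M → ℝ} {w : Symplectization M} (hh : MDiffAt h w.2)
    (v : TangentSpace (𝓘(ℝ, ℝ).prod I) w) :
    mvfderiv (𝓘(ℝ, ℝ).prod I) (fun z : Symplectization M => h z.2) w v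
      = mvfderiv I h w.2 (v.2 : TangentSpace I w.2) := by
  have := mvfderiv_comp_apply (I := I) (I' := 𝓘(ℝ, ℝ).prod I) (g := h)
    (f := (Prod.snd : Symplectization M → M)) w hh mdifferentiableAt_snd v
  rw [mfderiv_snd] at this
  exact this

lemma mvfderiv_val [I.Boundaryless] (w : Symplectization M) (v : TangentSpace (𝓘(ℝ, ℝ).prod I) w) :
    mvfderiv (𝓘(ℝ, ℝ).prod I) (fun z : Symplectization M => (z.1 : ℝ)) w v = v.1 := by
  have h1 : (fun z : Symplectization M => (z.1 : ℝ)) ∘ (extChartAt (𝓘(ℝ, ℝ).prod I) w).symm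
      =ᶠ[nhds (extChartAt (𝓘(ℝ, ℝ).prod I) w w)] fun p : ℝ × E => p.1 := by
    filter_upwards [extChartAt_target_mem_nhds (I := 𝓘(ℝ, ℝ).prod I) w] with p hp
    have h2 := (extChartAt (𝓘(ℝ, ℝ).prod I) w).right_inv hp
    have h3 := congrArg Prod.fst h2
    rw [extChartAt_prod] at h3 ⊢
    exact h3
  rw [mvfderiv_eq_fderiv (h1.differentiableAt_iff.2 differentiableAt_fst), h1.fderiv_eq]
  exact congrArg (fun L : ℝ × E →L[ℝ] ℝ => L v) fderiv_fst

omit [IsManifold I ∞ M] in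
lemma contMDiff_val : ContMDiff (𝓘(ℝ, ℝ).prod I) 𝓘(ℝ, ℝ) ∞
    (fun z : Symplectization M => (z.1 : ℝ)) :=
  contMDiff_subtype_val.comp contMDiff_fst

lemma formDifferentiableAt_dtForm [I.Boundaryless] (w : Symplectization M) :
    FormDifferentiableAt (𝓘(ℝ, ℝ).prod I) (dtForm I) w := by
  intro Y hY
  have h2 : (2 : ℕ∞ω) ≤ ∞ := WithTop.coe_le_coe.2 le_top
  have := formDifferentiableAt_mvfderiv (I := 𝓘(ℝ, ℝ).prod I)
    ((contMDiff_val (I := I) w).of_le h2) Y hY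
  simp only [mvfderiv_val] at this
  exact this

lemma mdifferentiableAt_projM {w : Symplectization M}
    {Y : Π z : Symplectization M, TangentSpace (𝓘(ℝ, ℝ).prod I) z}
    (hY : MDifferentiableAt (𝓘(ℝ, ℝ).prod I) (𝓘(ℝ, ℝ).prod I).tangent
      (fun z => (TotalSpace.mk' (ℝ × E) z (Y z) :
        TangentBundle (𝓘(ℝ, ℝ).prod I) (Symplectization M))) w) :
    MDifferentiableAt (𝓘(ℝ, ℝ).prod I) I.tangent
      (fun z => (TotalSpace.mk' E z.2 (projM I z (Y z)) : TangentBundle I M)) w := by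
  have h1 : ContMDiff (𝓘(ℝ, ℝ).prod I).tangent I.tangent 1
      (tangentMap (𝓘(ℝ, ℝ).prod I) I (Prod.snd : Symplectization M → M)) :=
    (contMDiff_snd (n := ∞)).contMDiff_tangentMap (WithTop.coe_le_coe.2 le_top)
  have h2 := (h1.mdifferentiable (by simp) _).comp w hY
  have h3 : tangentMap (𝓘(ℝ, ℝ).prod I) I (Prod.snd : Symplectization M → M) ∘
      (fun z => (TotalSpace.mk' (ℝ × E) z (Y z) :
        TangentBundle (𝓘(ℝ, ℝ).prod I) (Symplectization M)))
      = fun z => (TotalSpace.mk' E z.2 (projM I z (Y z)) : TangentBundle I M) := by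
    funext z
    simp only [Function.comp_apply, tangentMap_prodSnd]
    rfl
  rwa [h3] at h2

omit [IsManifold I ∞ M] in
lemma sympMetric_apply (g : Π x : M, TangentSpace I x →L[ℝ] TangentSpace I x →L[ℝ] ℝ)
    (w : Symplectization M) (u v : TangentSpace (𝓘(ℝ, ℝ).prod I) w) :
    sympMetric I g w u v = g w.2 (projM I w u) (projM I w v) + dtForm I w u * dtForm I w v := by
  simp [sympMetric]

variable (G : ContMDiffRiemannianMetric I ∞ E (fun x : M => TangentSpace I x))

lemma sympMetric_symm (w : Symplectization M) (u v : TangentSpace (𝓘(ℝ, ℝ).prod I) w) :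
    sympMetric I G.inner w u v = sympMetric I G.inner w v u := by
  rw [sympMetric_apply, sympMetric_apply, G.symm, mul_comm]

lemma sympMetric_pos (w : Symplectization M) (v : TangentSpace (𝓘(ℝ, ℝ).prod I) w) (hv : v ≠ 0) :
    0 < sympMetric I G.inner w v v := by
  rw [sympMetric_apply]
  by_cases h : projM I w v = 0
  · have : dtForm I w v ≠ 0 := fun h' => hv (Prod.ext h' h)
    rw [h, map_zero]
    simpa using this
  · have := G.pos w.2 _ h
    have := mul_self_nonneg (dtForm I w v)
    linarith

lemma metricDifferentiableAt_sympMetric [I.Boundaryless] (w : Symplectization M) :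
    MetricDifferentiableAt (𝓘(ℝ, ℝ).prod I) (sympMetric I G.inner) w := by
  intro X Y hX hY
  have h0 : MDifferentiableAt (𝓘(ℝ, ℝ).prod I) (I.prod 𝓘(ℝ, E →L[ℝ] E →L[ℝ] ℝ))
      (fun z : Symplectization M => TotalSpace.mk' (E →L[ℝ] E →L[ℝ] ℝ)
        (E := fun x : M => TangentSpace I x →L[ℝ] TangentSpace I x →L[ℝ] ℝ) z.2 (G.inner z.2)) w :=
    ((metric_contMDiff G w.2).mdifferentiableAt (by simp)).comp w mdifferentiableAt_snd
  have h : MDifferentiableAt (𝓘(ℝ, ℝ).prod I) (I.prod 𝓘(ℝ, ℝ))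
      (fun z : Symplectization M => TotalSpace.mk' ℝ (E := Bundle.Trivial M ℝ) z.2
        (G.inner z.2 (projM I z (X z)) (projM I z (Y z)))) w :=
    MDifferentiableAt.clm_bundle_apply₂ (F₁ := E) (F₂ := E) h0 (mdifferentiableAt_projM hX)
      (mdifferentiableAt_projM hY)
  simp only [mdifferentiableAt_totalSpace] at h
  have h1 := MDifferentiableAt.add h.2 (MDifferentiableAt.mul
    (formDifferentiableAt_dtForm w X hX) (formDifferentiableAt_dtForm w Y hY))
  simp only [sympMetric_apply]
  exact h1

end SymplectizationTangent

/-! ### The Hessian and the Levi form of the symplectization, computed on `M` -/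

section SymplectizationLevi

variable {E : Type*} [NormedAddCommGroup E] [NormedSpace ℝ E] [FiniteDimensional ℝ E]
  {H : Type*} [TopologicalSpace H] {I : ModelWithCorners ℝ E H} [I.Boundaryless]
  {M : Type*} [TopologicalSpace M] [ChartedSpace H M] [IsManifold I ∞ M]
  {G : ContMDiffRiemannianMetric I ∞ E (fun x : M => TangentSpace I x)}
  {α : Π x : M, TangentSpace I x →L[ℝ] ℝ} {R : Π x : M, TangentSpace I x}
  {J : Π x : M, TangentSpace I x →L[ℝ] TangentSpace I x} {f : M → ℝ}

omit [I.Boundaryless] in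
lemma inner_riemGradient (G : ContMDiffRiemannianMetric I ∞ E (fun x : M => TangentSpace I x))
    (f : M → ℝ) (x : M) (w : TangentSpace I x) :
    G.inner x (riemGradient I G.inner f x) w = mvfderiv I f x w :=
  Classical.epsilon_spec
    (exists_forall_apply_eq (B := G.inner x) (G.pos x)
      (mvfderiv I f x : TangentSpace I x →ₗ[ℝ] ℝ)) w

omit [FiniteDimensional ℝ E] [I.Boundaryless] [IsManifold I ∞ M] in
lemma mvfderiv_eq_of_eventually_snd {F : Symplectization M → ℝ} {h : M → ℝ} {w : Symplectization M}
    (hF : F =ᶠ[nhds w] fun z => h z.2) (hh : MDiffAt h w.2)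
    (v : TangentSpace (𝓘(ℝ, ℝ).prod I) w) :
    mvfderiv (𝓘(ℝ, ℝ).prod I) F w v = mvfderiv I h w.2 (projM I w v) := by
  rw [hF.mvfderiv_eq]
  exact mvfderiv_comp_snd hh v

/-- Since `g + dt ⊗ dt` is a product metric, the Hessian on `W` of a function on `M` is its Hessian
on `M`, that is, the covariant derivative of `df`. -/
lemma sympHessian_eq (G : ContMDiffRiemannianMetric I ∞ E (fun x : M => TangentSpace I x))
    (hf : CMDiff ∞ f) (w : Symplectization M) (v : TangentSpace (𝓘(ℝ, ℝ).prod I) w) :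
    sympHessian I G.inner f w v v =
      covDerivForm I G.inner (mvfderiv I f) (extend E (riemGradient I G.inner f w.2))
        (extend E (projM I w v)) (extend E (projM I w v)) w.2 := by
  have h2 : (2 : ℕ∞ω) ≤ ∞ := WithTop.coe_le_coe.2 le_top
  set u := projM I w v with hu
  set z := riemGradient I G.inner f w.2 with hz
  let Z : TangentSpace (𝓘(ℝ, ℝ).prod I) w := inclM I w z
  have hfd : ∀ y, MDiffAt f y := fun y => (hf y).mdifferentiableAt (by simp)
  have hdf : ∀ (y : Symplectization M) V, mvfderiv (𝓘(ℝ, ℝ).prod I)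
      (fun p : Symplectization M => f p.2) y V = mvfderiv I f y.2 (projM I y V) := fun y V =>
    mvfderiv_comp_snd (hfd y.2) V
  have hext := fun (V : TangentSpace (𝓘(ℝ, ℝ).prod I) w) =>
    (eventually_mem_chart_source (H := H) w).mono fun y hy => extend_symplectization (I := I) hy V
  have hZp : projM I w Z = z := rfl
  have hZt : dtForm I w Z = 0 := rfl
  have hext0 : ∀ u : TangentSpace I w.2, MDiffAt (T% (extend E u)) w.2 := fun u =>
    mdifferentiableAt_extend I E u
  have hm := metricDifferentiableAt G w.2
  -- The second derivative of `f`.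
  have e1 : mvfderiv (𝓘(ℝ, ℝ).prod I) (fun y => mvfderiv (𝓘(ℝ, ℝ).prod I)
      (fun p : Symplectization M => f p.2) y (extend (ℝ × E) v y)) w v =
      mvfderiv I (fun y => mvfderiv I f y (extend E u y)) w.2 u := by
    refine mvfderiv_eq_of_eventually_snd (h := fun y => mvfderiv I f y (extend E u y)) ?_ ?_ v
    · filter_upwards [hext v] with y hy
      rw [hdf, hy.2]
    · exact formDifferentiableAt_mvfderiv ((hf w.2).of_le h2) _ (hext0 u)
  -- The Levi-Civita term, by the Koszul formula on `W` tested against `∇f`.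
  have e2 : mvfderiv (𝓘(ℝ, ℝ).prod I) (fun p : Symplectization M => f p.2) w
      (leviCivita (𝓘(ℝ, ℝ).prod I) (sympMetric I G.inner) (extend (ℝ × E) v) (extend (ℝ × E) v) w)
      = (1 / 2) * koszul I G.inner (extend E u) (extend E u) (extend E z) w.2 := by
    have hk := two_mul_leviCivita (metricDifferentiableAt_sympMetric G w) (sympMetric_symm G)
      (sympMetric_pos G w) (mdifferentiableAt_extend (𝓘(ℝ, ℝ).prod I) (ℝ × E) v)
      (mdifferentiableAt_extend (𝓘(ℝ, ℝ).prod I) (ℝ × E) v)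
      (mdifferentiableAt_extend (𝓘(ℝ, ℝ).prod I) (ℝ × E) Z)
    have hl : ∀ V, sympMetric I G.inner w V (extend (ℝ × E) Z w) =
        mvfderiv (𝓘(ℝ, ℝ).prod I) (fun p : Symplectization M => f p.2) w V := by
      intro V
      rw [extend_apply_self, sympMetric_apply, hZp, hZt, mul_zero, add_zero, G.symm,
        inner_riemGradient, hdf]
    rw [hl] at hk
    have k1 : mvfderiv (𝓘(ℝ, ℝ).prod I) (fun y => sympMetric I G.inner y (extend (ℝ × E) v y)
        (extend (ℝ × E) Z y)) w v
        = mvfderiv I (fun y => G.inner y (extend E u y) (extend E z y)) w.2 u := by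
      refine mvfderiv_eq_of_eventually_snd
        (h := fun y => G.inner y (extend E u y) (extend E z y)) ?_ (hm _ _ (hext0 u) (hext0 z)) v
      filter_upwards [hext v, hext Z] with y hy hy'
      rw [sympMetric_apply, hy.2, hy'.2, hy'.1, hZt, mul_zero, add_zero, hZp]
    have k2 : mvfderiv (𝓘(ℝ, ℝ).prod I) (fun y => sympMetric I G.inner y (extend (ℝ × E) v y)
        (extend (ℝ × E) v y)) w Z
        = mvfderiv I (fun y => G.inner y (extend E u y) (extend E u y)) w.2 z := by
      have hd := hm _ _ (hext0 u) (hext0 u)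
      have := mvfderiv_add_apply hd
        (mdifferentiableAt_const (c := dtForm I w v * dtForm I w v)) z
      rw [mvfderiv_const, zero_apply, add_zero] at this
      rw [← this]
      refine mvfderiv_eq_of_eventually_snd
        (h := fun y => G.inner y (extend E u y) (extend E u y) + dtForm I w v * dtForm I w v) ?_
        (MDifferentiableAt.add hd mdifferentiableAt_const) Z
      filter_upwards [hext v] with y hy
      rw [sympMetric_apply, hy.2, hy.1]
    simp only [koszul, mlieBracket_extend_self, extend_apply_self, map_zero, zero_apply, k1, k2]
      at hk ⊢
    linarith
  simp only [sympHessian, hessian, e1, e2, covDerivForm, extend_apply_self]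


omit [FiniteDimensional ℝ E] [I.Boundaryless] in
lemma projM_sympJ (w : Symplectization M) (v : TangentSpace (𝓘(ℝ, ℝ).prod I) w) :
    projM I w (sympJ I G.inner α R J w v)
      = J w.2 (projM I w v) + dtForm I w v • unitReeb I G.inner R w.2 := by
  have h1 : ∀ u, projM I w (inclM I w u) = u := fun u => rfl
  have h2 : projM I w (partialT I w) = 0 := rfl
  simp [sympJ, h1, h2]

omit [FiniteDimensional ℝ E] [I.Boundaryless] in
lemma dtForm_sympJ (w : Symplectization M) (v : TangentSpace (𝓘(ℝ, ℝ).prod I) w) :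
    dtForm I w (sympJ I G.inner α R J w v)
      = -(reebNorm I G.inner R w.2 * α w.2 (projM I w v)) := by
  have h1 : ∀ u, dtForm I w (inclM I w u) = 0 := fun u => rfl
  have h2 : dtForm I w (partialT I w) = 1 := rfl
  simp [sympJ, h1, h2]

/-- The Levi form in terms of vector fields on `M`: for `v = u + b ∂_t` and `a = ρ α(u)`, with a
section `X` of `ξ` such that `U = X + a n` equals `u` at the point, and with `P = J X + b n`,
`L(v, v) = U(Uf) + P(Pf) + df(J [U, P])`. -/
lemma leviForm_eq (h : IsWeaklyCompatible I G.inner α R J) (hf : CMDiff ∞ f)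
    (w : Symplectization M) (v : TangentSpace (𝓘(ℝ, ℝ).prod I) w) (a b : ℝ)
    (ha : reebNorm I G.inner R w.2 * α w.2 (projM I w v) = a) (hb : dtForm I w v = b)
    {X U P : Π x : M, TangentSpace I x} (hXξ : ∀ y, α y (X y) = 0)
    (hX : CMDiffAt 2 (T% X) w.2) (hUv : U w.2 = projM I w v)
    (hU : U = fun y => X y + a • unitReeb I G.inner R y)
    (hP : P = fun y => J y (X y) + b • unitReeb I G.inner R y) :
    leviForm I G.inner α R J f w v v =
      mvfderiv I (fun y => mvfderiv I f y (U y)) w.2 (U w.2)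
      + mvfderiv I (fun y => mvfderiv I f y (P y)) w.2 (P w.2)
      + mvfderiv I f w.2 (J w.2 (mlieBracket I U P w.2)) := by
  have h2 : (2 : ℕ∞ω) ≤ ∞ := WithTop.coe_le_coe.2 le_top
  have hn : MDiffAt (T% (unitReeb I G.inner R)) w.2 :=
    (h.contMDiff_unitReeb w.2).mdifferentiableAt (by simp)
  have hcn : ∀ c : ℝ, MDiffAt (T% (fun y => c • unitReeb I G.inner R y)) w.2 := fun c =>
    (mdifferentiableAt_const (c := c)).smul_section hn
  have hXd : MDiffAt (T% X) w.2 := hX.mdifferentiableAt (by simp)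
  have hUd : MDiffAt (T% U) w.2 := by
    rw [hU]; exact mdifferentiableAt_add_section hXd (hcn a)
  have hPd : MDiffAt (T% P) w.2 := by
    rw [hP]; exact mdifferentiableAt_add_section (h.mdifferentiableAt_complex hXd) (hcn b)
  have hJU : ∀ y, J y (U y) = J y (X y) := fun y => by
    rw [hU]; simp [h.complex_unitReeb]
  have hJP : ∀ y, J y (P y) = - X y := fun y => by
    rw [hP]; simp [h.complex_unitReeb, h.complex.sq _ _ (hXξ y)]
  have hfd : ∀ y, MDiffAt f y := fun y => (hf y).mdifferentiableAt (by simp)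
  have hdfd : FormDifferentiableAt I (mvfderiv I f) w.2 :=
    formDifferentiableAt_mvfderiv ((hf w.2).of_le h2)
  set γ : Π x : M, TangentSpace I x →L[ℝ] ℝ := fun y => (mvfderiv I f y).comp (J y) with hγ
  have hγd : FormDifferentiableAt I γ w.2 := fun Y hY => hdfd _ (h.mdifferentiableAt_complex hY)
  have hφd : MDiffAt (fun y => mvfderiv I f y (unitReeb I G.inner R y)) w.2 := hdfd _ hn
  have hcφd : ∀ c : ℝ, MDiffAt (fun y => c * mvfderiv I f y (unitReeb I G.inner R y)) w.2 :=
    fun c => MDifferentiableAt.mul mdifferentiableAt_const hφd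
  -- The 1-form `df ∘ J` on `W` is `γ + df(n) dt`.
  have hβ : ∀ (z : Symplectization M) V,
      (mvfderiv (𝓘(ℝ, ℝ).prod I) (fun p : Symplectization M => f p.2) z) (sympJ I G.inner α R J z V)
        = γ z.2 (projM I z V)
          + dtForm I z V * mvfderiv I f z.2 (unitReeb I G.inner R z.2) := by
    intro z V
    have h1 := mvfderiv_comp_snd (hfd z.2) (sympJ I G.inner α R J z V)
    refine h1.trans ((congrArg (mvfderiv I f z.2) (projM_sympJ (I := I) z V)).trans ?_)
    rw [map_add, map_smul, smul_eq_mul]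
    rfl
  have hJv1 : projM I w (sympJ I G.inner α R J w v) = P w.2 := by
    rw [projM_sympJ, hb, hP, ← hUv]
    simp only [hJU]
  have hJv2 : dtForm I w (sympJ I G.inner α R J w v) = -a := by
    rw [dtForm_sympJ, ha]
  have hder : ∀ V V' : TangentSpace (𝓘(ℝ, ℝ).prod I) w,
      mvfderiv (𝓘(ℝ, ℝ).prod I) (fun z => (mvfderiv (𝓘(ℝ, ℝ).prod I)
        (fun p : Symplectization M => f p.2) z) (sympJ I G.inner α R J z (extend (ℝ × E) V z))) w V'
      = mvfderiv I (fun y => γ y (extend E (projM I w V) y)) w.2 (projM I w V')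
        + dtForm I w V * mvfderiv I (fun y => mvfderiv I f y (unitReeb I G.inner R y)) w.2
          (projM I w V') := by
    intro V V'
    have hd := hγd _ (mdifferentiableAt_extend I E (projM I w V))
    rw [← mvfderiv_const_mul_apply _ hφd, ← mvfderiv_add_apply hd (hcφd _)]
    refine mvfderiv_eq_of_eventually_snd (h := fun y => γ y (extend E (projM I w V) y) +
      dtForm I w V * mvfderiv I f y (unitReeb I G.inner R y)) ?_
      (MDifferentiableAt.add hd (hcφd _)) V'
    filter_upwards [eventually_mem_chart_source (H := H) w] with y hy
    have := extend_symplectization (I := I) hy V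
    rw [hβ, this.1, this.2]
  have hext : extDerivOne I γ w.2 (U w.2) (P w.2)
      = mvfderiv I (fun y => γ y (extend E (P w.2) y)) w.2 (U w.2)
        - mvfderiv I (fun y => γ y (extend E (U w.2) y)) w.2 (P w.2) := by
    rw [extDerivOne, mlieBracket_extend_self, map_zero, sub_zero]
  rw [extDerivOne_eq hγd hUd hPd] at hext
  have hγP : (fun y => γ y (P y)) = fun y => a * mvfderiv I f y (unitReeb I G.inner R y)
      - mvfderiv I f y (U y) := by
    funext y
    simp only [hγ, ContinuousLinearMap.comp_apply, hJP]
    rw [hU]; simp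
  have hγU : (fun y => γ y (U y)) = fun y => mvfderiv I f y (P y)
      - b * mvfderiv I f y (unitReeb I G.inner R y) := by
    funext y
    simp only [hγ, ContinuousLinearMap.comp_apply, hJU]
    rw [hP]; simp
  rw [hγP, hγU, mvfderiv_sub_apply (hcφd _) (hdfd _ hUd), mvfderiv_sub_apply (hdfd _ hPd) (hcφd _),
    mvfderiv_const_mul_apply _ hφd, mvfderiv_const_mul_apply _ hφd] at hext
  simp only [leviForm, extDerivOne, ContinuousLinearMap.comp_apply]
  rw [hder, hder, mlieBracket_extend_self, map_zero, map_zero, hJv1, hJv2, hb, ← hUv]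
  have hγb : γ w.2 (mlieBracket I U P w.2) = mvfderiv I f w.2 (J w.2 (mlieBracket I U P w.2)) := rfl
  rw [hγb] at hext
  linarith

end SymplectizationLevi

/-! ### The Levi form on complex tangencies -/

section LeviForm

variable {E : Type*} [NormedAddCommGroup E] [NormedSpace ℝ E] [FiniteDimensional ℝ E]
  {H : Type*} [TopologicalSpace H] {I : ModelWithCorners ℝ E H} [I.Boundaryless]
  {M : Type*} [TopologicalSpace M] [ChartedSpace H M] [IsManifold I ∞ M]
  {G : ContMDiffRiemannianMetric I ∞ E (fun x : M => TangentSpace I x)}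
  {α : Π x : M, TangentSpace I x →L[ℝ] ℝ} {R : Π x : M, TangentSpace I x}
  {J : Π x : M, TangentSpace I x →L[ℝ] TangentSpace I x} {f : M → ℝ}

omit [FiniteDimensional ℝ E] [I.Boundaryless] in
/-- If `v ∈ 𝒞`, then `df` vanishes on the components in `TM` of `v` and of `J v`. -/
lemma mvfderiv_eq_zero_of_mem_complexTangencies (h : IsWeaklyCompatible I G.inner α R J)
    (hf : CMDiff ∞ f) {w : Symplectization M} {v : TangentSpace (𝓘(ℝ, ℝ).prod I) w}
    (hv : v ∈ complexTangencies I G.inner α R J f w) :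
    mvfderiv I f w.2 (projM I w v) = 0 ∧
      mvfderiv I f w.2 (projM I w (sympJ I G.inner α R J w v)) = 0 := by
  have hdf : ∀ V, mvfderiv (𝓘(ℝ, ℝ).prod I) (fun p : Symplectization M => f p.2) w V
      = mvfderiv I f w.2 (projM I w V) := fun V =>
    mvfderiv_comp_snd ((hf w.2).mdifferentiableAt (by simp)) V
  obtain ⟨h1, v', h2, rfl⟩ := hv
  refine ⟨(hdf _).symm.trans h1, ?_⟩
  have h2' : mvfderiv I f w.2 (projM I w v') = 0 := (hdf _).symm.trans h2
  have h3 : projM I w (sympJ I G.inner α R J w (sympJ I G.inner α R J w v')) = -projM I w v' := by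
    rw [projM_sympJ, projM_sympJ, dtForm_sympJ, map_add, map_smul, h.complex_unitReeb, smul_zero,
      add_zero, h.complex_complex, neg_smul, ← neg_add, h.contactPart_add_unitReeb]
  change mvfderiv I f w.2 (projM I w (sympJ I G.inner α R J w (sympJ I G.inner α R J w v'))) = 0
  rw [h3, map_neg, h2', neg_zero]

/-- If `dα = μ ⟨J·, ·⟩` near the point, then on complex tangencies the Levi form is the sum of the
two Hessians up to logarithmic derivatives of `ρ` and `μ`. -/
lemma leviForm_eq_hessian_add (h : IsWeaklyCompatible I G.inner α R J) (hf : CMDiff ∞ f)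
    {w : Symplectization M} {v : TangentSpace (𝓘(ℝ, ℝ).prod I) w}
    (hv : v ∈ complexTangencies I G.inner α R J f w) {μ : M → ℝ}
    (hμ : ∀ᶠ y in nhds w.2, ∀ v w, extDerivOne I α y v w = μ y * G.inner y (J y v) w)
    (hμd : MDiffAt μ w.2) (hμ0 : μ w.2 ≠ 0) (a b : ℝ)
    (ha : reebNorm I G.inner R w.2 * α w.2 (projM I w v) = a) (hb : dtForm I w v = b) :
    leviForm I G.inner α R J f w v v =
      sympHessian I G.inner f w v v
      + sympHessian I G.inner f w (sympJ I G.inner α R J w v) (sympJ I G.inner α R J w v)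
      + (reebNorm I G.inner R w.2)⁻¹ *
        ((a * mvfderiv I (reebNorm I G.inner R) w.2 (projM I w v)
            + b * mvfderiv I (reebNorm I G.inner R) w.2 (projM I w (sympJ I G.inner α R J w v)))
          * mvfderiv I f w.2 (unitReeb I G.inner R w.2)
        - (a ^ 2 + b ^ 2)
          * mvfderiv I (reebNorm I G.inner R) w.2 (riemGradient I G.inner f w.2))
      + (μ w.2)⁻¹ * ((a * mvfderiv I μ w.2 (projM I w v)
            + b * mvfderiv I μ w.2 (projM I w (sympJ I G.inner α R J w v)))
          * mvfderiv I f w.2 (unitReeb I G.inner R w.2)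
        + mvfderiv I μ w.2 (riemGradient I G.inner f w.2)
          * G.inner w.2 (contactPart I G.inner R w.2 (projM I w v))
            (contactPart I G.inner R w.2 (projM I w v))) := by
  have h2 : (2 : ℕ∞ω) ≤ ∞ := WithTop.coe_le_coe.2 le_top
  obtain ⟨hu, hp⟩ := mvfderiv_eq_zero_of_mem_complexTangencies h hf hv
  have hpv : projM I w (sympJ I G.inner α R J w v)
      = J w.2 (projM I w v) + b • unitReeb I G.inner R w.2 := by rw [projM_sympJ, hb]
  set u := projM I w v with hudef
  set X : Π y : M, TangentSpace I y := contactExtend I G.inner R u with hXdef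
  have hXξ : ∀ y, α y (X y) = 0 := fun y => h.apply_contactPart y _
  have hX : CMDiffAt 2 (T% X) w.2 := (h.contMDiffAt_contactExtend u).of_le h2
  have hXx : X w.2 = contactPart I G.inner R w.2 u := by
    simp only [hXdef, contactExtend, extend_apply_self]
  obtain ⟨U, hU⟩ : ∃ U : Π y : M, TangentSpace I y, U = fun y => X y + a • unitReeb I G.inner R y :=
    ⟨_, rfl⟩
  obtain ⟨P, hP⟩ : ∃ P : Π y : M, TangentSpace I y,
    P = fun y => J y (X y) + b • unitReeb I G.inner R y := ⟨_, rfl⟩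
  have hUx : U w.2 = u := by
    rw [hU]
    simp only [hXx]
    rw [← ha, h.contactPart_add_unitReeb]
  have hPx : P w.2 = projM I w (sympJ I G.inner α R J w v) := by
    rw [hpv, hP]
    simp only [hXx]
    rw [h.complex_contactPart]
  have hn : CMDiffAt 2 (T% (unitReeb I G.inner R)) w.2 := (h.contMDiff_unitReeb w.2).of_le h2
  have hcn : ∀ c : ℝ, CMDiffAt 2 (T% (fun y => c • unitReeb I G.inner R y)) w.2 := fun c =>
    (contMDiffAt_const (c := c)).smul_section hn
  have hUd : MDiffAt (T% U) w.2 := by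
    rw [hU]; exact (hX.add_section (hcn a)).mdifferentiableAt (by simp)
  have hPd : MDiffAt (T% P) w.2 := by
    rw [hP]
    exact ((h.contMDiffAt_complex h2 hX).add_section (hcn b)).mdifferentiableAt (by simp)
  set z := riemGradient I G.inner f w.2 with hz
  have hZ : CMDiffAt 2 (T% (extend E z)) w.2 := contMDiffAt_extend I E z
  have hZv : ∀ v, G.inner w.2 (extend E z w.2) v = mvfderiv I f w.2 v := fun v => by
    rw [extend_apply_self, inner_riemGradient]
  have hZv' : ∀ v, G.inner w.2 v (extend E z w.2) = mvfderiv I f w.2 v := fun v => by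
    rw [G.symm, hZv]
  have hdfd : FormDifferentiableAt I (mvfderiv I f) w.2 :=
    formDifferentiableAt_mvfderiv ((hf w.2).of_le h2)
  have hext : ∀ u : TangentSpace I w.2, MDiffAt (T% (extend E u)) w.2 := fun u =>
    mdifferentiableAt_extend I E u
  have hH : ∀ {Y : Π y : M, TangentSpace I y} {V : TangentSpace (𝓘(ℝ, ℝ).prod I) w},
      MDiffAt (T% Y) w.2 → Y w.2 = projM I w V → sympHessian I G.inner f w V V =
      mvfderiv I (fun y => mvfderiv I f y (Y y)) w.2 (Y w.2)
        - (1 / 2) * koszul I G.inner Y Y (extend E z) w.2 := by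
    intro Y V hY hYV
    rw [sympHessian_eq G hf w V, covDerivForm_congr (metricDifferentiableAt G w.2) G.symm hdfd
      (hext z) hZv (hext _) hY (hext _) hY (by simp [hYV]) (by simp [hYV])]
    rfl
  have hK := h.koszul_add_koszul_eq hμ hμd hμ0 a b hXξ hX hZ hU hP
  rw [hZv', hZv', hZv', hZv', extend_apply_self, hUx, hPx, hXx] at hK
  have hdX : mvfderiv I f w.2 (contactPart I G.inner R w.2 u)
      = -(a * mvfderiv I f w.2 (unitReeb I G.inner R w.2)) := by
    have := h.contactPart_add_unitReeb w.2 u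
    rw [ha] at this
    have h3 := congrArg (mvfderiv I f w.2) this
    rw [hu, map_add, map_smul, smul_eq_mul] at h3
    linarith
  have hdJX : mvfderiv I f w.2 (J w.2 (contactPart I G.inner R w.2 u))
      = -(b * mvfderiv I f w.2 (unitReeb I G.inner R w.2)) := by
    rw [hpv, map_add, map_smul, smul_eq_mul] at hp
    rw [h.complex_contactPart]
    linarith
  rw [hdX, hdJX] at hK
  rw [leviForm_eq h hf w v a b ha hb hXξ hX hUx hU hP, hH hUd hUx, hH hPd hPx]
  linarith

end LeviForm

/-! ### Proportionality of `dα` and `⟨J·, ·⟩` -/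

section Proportional

variable {E : Type*} [NormedAddCommGroup E] [NormedSpace ℝ E] [FiniteDimensional ℝ E]
  {H : Type*} [TopologicalSpace H] {I : ModelWithCorners ℝ E H} [I.Boundaryless]
  {M : Type*} [TopologicalSpace M] [ChartedSpace H M] [IsManifold I ∞ M]
  {G : ContMDiffRiemannianMetric I ∞ E (fun x : M => TangentSpace I x)}
  {α : Π x : M, TangentSpace I x →L[ℝ] ℝ} {R : Π x : M, TangentSpace I x}
  {J : Π x : M, TangentSpace I x →L[ℝ] TangentSpace I x} {f : M → ℝ}

omit [I.Boundaryless] in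
lemma extDerivOne_add_smul_left {β : Π x : M, TangentSpace I x →L[ℝ] ℝ} {x : M}
    (hβ : FormDifferentiableAt I β x) (u v w : TangentSpace I x) (c : ℝ) :
    extDerivOne I β x (u + c • v) w = extDerivOne I β x u w + c * extDerivOne I β x v w := by
  have hu := mdifferentiableAt_extend I E u
  have hv := mdifferentiableAt_extend I E v
  have hw := mdifferentiableAt_extend I E w
  have hcv : MDiffAt (T% (c • extend E v : Π y : M, TangentSpace I y)) x :=
    (mdifferentiableAt_const (c := c)).smul_section hv
  have h := extDerivOne_eq (X := extend E u + c • extend E v) hβ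
    (mdifferentiableAt_add_section hu hcv) hw
  simp only [Pi.add_apply, Pi.smul_apply, extend_apply_self, map_add, map_smul, smul_eq_mul] at h
  have hcβ : MDiffAt (fun y => c * β y (extend E v y)) x :=
    MDifferentiableAt.mul mdifferentiableAt_const (hβ _ hv)
  rw [h, mvfderiv_add_apply (hβ _ hu) hcβ,
    mvfderiv_const_mul_apply _ (hβ _ hv), mlieBracket_add_left hu hcv,
    mlieBracket_const_smul_left hv]
  simp only [extDerivOne, map_add, map_smul, smul_eq_mul, mlieBracket_extend_self, map_zero]
  ring

omit [FiniteDimensional ℝ E] [I.Boundaryless] in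
lemma extDerivOne_self (β : Π x : M, TangentSpace I x →L[ℝ] ℝ) (x : M) (u : TangentSpace I x) :
    extDerivOne I β x u u = 0 := by
  have := extDerivOne_swap β x u u
  linarith

omit [FiniteDimensional ℝ E] [I.Boundaryless] in
lemma sympNorm_sq (w : Symplectization M) (v : TangentSpace (𝓘(ℝ, ℝ).prod I) w) :
    sympNorm I G.inner w v ^ 2 = G.inner w.2 (projM I w v) (projM I w v) + dtForm I w v ^ 2 := by
  have : 0 ≤ sympMetric I G.inner w v v := by
    by_cases hv : v = 0
    · simp [hv]
    · exact (sympMetric_pos G w v hv).le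
  rw [sympNorm, gNorm, Real.sq_sqrt this, sympMetric_apply, sq]

omit [I.Boundaryless] in
/-- `‖∇f‖ ⟨n_S, w⟩ = df(w)`; where `∇f = 0` both sides vanish. -/
lemma gNorm_mul_inner_levelNormal (f : M → ℝ) (x : M) (w : TangentSpace I x) :
    gNorm I G.inner x (riemGradient I G.inner f x) * G.inner x (levelNormal I G.inner f x) w
      = mvfderiv I f x w := by
  rw [levelNormal, map_smul, smul_apply, inner_riemGradient, smul_eq_mul]
  by_cases hz : riemGradient I G.inner f x = 0
  · rw [← inner_riemGradient G, hz]; simp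
  · rw [mul_inv_cancel_left₀]
    exact (Real.sqrt_pos.2 (G.pos x _ hz)).ne'

omit [FiniteDimensional ℝ E] [I.Boundaryless] [IsManifold I ∞ M] in
lemma mvfderiv_log {h : M → ℝ} {x : M} (hh : MDiffAt h x) (h0 : h x ≠ 0) (v : TangentSpace I x) :
    mvfderiv I (fun y => Real.log (h y)) x v = (h x)⁻¹ * mvfderiv I h x v := by
  have hl := Real.differentiableAt_log h0
  have := mvfderiv_comp_apply (I := 𝓘(ℝ, ℝ)) x hl.mdifferentiableAt hh v
  refine this.trans ?_
  have h1 : mvfderiv 𝓘(ℝ, ℝ) Real.log (h x) = fderiv ℝ Real.log (h x) := by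
    simp only [mvfderiv, mfderiv_eq_fderiv]
    rfl
  have h2 : ∀ a : ℝ, fderiv ℝ Real.log (h x) a = (h x)⁻¹ * a := fun a => by
    rw [(Real.hasDerivAt_log h0).hasFDerivAt.fderiv]
    simp [mul_comm]
  exact (congrArg (fun L : ℝ →L[ℝ] ℝ => L (mvfderiv I h x v)) h1).trans (h2 _)

namespace IsCRCompatible

omit [FiniteDimensional ℝ E] [I.Boundaryless] in
lemma isWeaklyCompatible (h : IsCRCompatible I G.inner α R J) :
    IsWeaklyCompatible I G.inner α R J where
  contact := h.contact
  reebField := h.reebField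
  orthogonal := h.orthogonal
  complex := h.complex
  isometric x u v hu hv := by
    obtain ⟨θ, -, hθ⟩ := h.metric
    rw [hθ x _ _ (h.complex.mem x u) (h.complex.mem x v), hθ x _ _ hu hv,
      h.complex.invariant x _ _ hu (h.complex.mem x v)]

end IsCRCompatible

omit [I.Boundaryless] in
lemma exists_unit_mem_ker (hdim : Module.finrank ℝ E = 3) (x : M) :
    ∃ e : TangentSpace I x, α x e = 0 ∧ G.inner x e e = 1 := by
  have hfd : FiniteDimensional ℝ (TangentSpace I x) := inferInstanceAs (FiniteDimensional ℝ E)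
  have hker := LinearMap.ker_ne_bot_of_finrank_lt (f := (α x : TangentSpace I x →ₗ[ℝ] ℝ))
    (by rw [Module.finrank_self, show Module.finrank ℝ (TangentSpace I x) = 3 from hdim]; norm_num)
  obtain ⟨v, hv, hv0⟩ := Submodule.exists_mem_ne_zero_of_ne_bot hker
  have hpos := G.pos x v hv0
  have hsq := Real.sq_sqrt hpos.le
  have hs := (Real.sqrt_pos.2 hpos).ne'
  refine ⟨(√(G.inner x v v))⁻¹ • v, ?_, ?_⟩
  · rw [map_smul, show α x v = 0 from hv, smul_zero]
  · rw [map_smul, map_smul, smul_apply, smul_eq_mul, smul_eq_mul]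
    nth_rewrite 3 [← hsq]
    field_simp

namespace IsWeaklyCompatible

variable (h : IsWeaklyCompatible I G.inner α R J)
include h

omit [I.Boundaryless] in
lemma extDerivOne_contactPart (x : M) (v w : TangentSpace I x) :
    extDerivOne I α x (contactPart I G.inner R x v) (contactPart I G.inner R x w)
      = extDerivOne I α x v w := by
  have h1 : ∀ v w, extDerivOne I α x (contactPart I G.inner R x v) w = extDerivOne I α x v w := by
    intro v w
    rw [h.contactPart_eq, sub_eq_add_neg, ← neg_smul,
      extDerivOne_add_smul_left (h.formDifferentiableAt x), h.reebField.contract, mul_zero,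
      add_zero]
  rw [h1, extDerivOne_swap, h1, ← extDerivOne_swap]

omit [FiniteDimensional ℝ E] [I.Boundaryless] in
lemma inner_complex_contactPart (x : M) (v w : TangentSpace I x) :
    G.inner x (J x (contactPart I G.inner R x v)) (contactPart I G.inner R x w)
      = G.inner x (J x v) w := by
  rw [h.complex_contactPart, h.inner_complex_skew, h.complex_contactPart, ← h.inner_complex_skew]

omit [FiniteDimensional ℝ E] [I.Boundaryless] in
lemma inner_complex_self (x : M) (v : TangentSpace I x) : G.inner x (J x v) v = 0 := by
  have := h.inner_complex_skew x v v
  linarith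

omit [I.Boundaryless] in
/-- In dimension three, every vector is expanded in the orthogonal frame `e`, `J e`, `n`; the
formula is multiplied by `‖e‖²` so as to include `e = 0`. -/
lemma inner_self_smul (hdim : Module.finrank ℝ E = 3) {x : M} {e : TangentSpace I x}
    (he : α x e = 0) (w : TangentSpace I x) :
    G.inner x e e • w = G.inner x e w • e + G.inner x (J x e) w • J x e
      + (G.inner x e e * G.inner x (unitReeb I G.inner R x) w) • unitReeb I G.inner R x := by
  by_cases he0 : e = 0
  · simp [he0]
  have hfd : FiniteDimensional ℝ (TangentSpace I x) := inferInstanceAs (FiniteDimensional ℝ E)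
  set n := unitReeb I G.inner R x with hn
  have hee := G.pos x e he0
  have hJJ : G.inner x (J x e) (J x e) = G.inner x e e := h.isometric x e e he he
  have hJe : G.inner x (J x e) e = 0 := h.inner_complex_self x e
  have heJ : G.inner x e (J x e) = 0 := by rw [G.symm, hJe]
  have hne : G.inner x n e = 0 := h.inner_unitReeb_of_mem he
  have hnJ : G.inner x n (J x e) = 0 := h.inner_unitReeb_of_mem (h.complex.mem x e)
  have hen : G.inner x e n = 0 := by rw [G.symm, hne]
  have hJn : G.inner x (J x e) n = 0 := by rw [G.symm, hnJ]
  have hnn : G.inner x n n = 1 := h.inner_unitReeb_self x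
  -- The difference of the two sides is orthogonal to `e`, `J e`, `n`; if it were not zero, there
  -- would be four independent vectors.
  by_contra hD
  set D := G.inner x e e • w - (G.inner x e w • e + G.inner x (J x e) w • J x e
      + (G.inner x e e * G.inner x n w) • n) with hDdef
  have hD0 : D ≠ 0 := fun h0 => hD (sub_eq_zero.1 h0)
  have heD : G.inner x e D = 0 := by
    simp only [hDdef, map_sub, map_add, map_smul, smul_eq_mul, heJ, hen]; ring
  have hJD : G.inner x (J x e) D = 0 := by
    simp only [hDdef, map_sub, map_add, map_smul, smul_eq_mul, hJe, hJn, hJJ]; ring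
  have hnD : G.inner x n D = 0 := by
    simp only [hDdef, map_sub, map_add, map_smul, smul_eq_mul, hne, hnJ, hnn]; ring
  let B : TangentSpace I x →ₗ[ℝ] (TangentSpace I x →ₗ[ℝ] ℝ) :=
    { toFun := fun v => (G.inner x v : TangentSpace I x →ₗ[ℝ] ℝ)
      map_add' := fun v w => by ext; simp
      map_smul' := fun c w => by ext; simp }
  have hB : ∀ v w, B v w = G.inner x v w := fun v w => rfl
  have hli : LinearIndependent ℝ ![e, J x e, n, D] := by
    refine LinearMap.linearIndependent_of_isOrthoᵢ (B := B) ?_ ?_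
    · intro i j hij
      change B _ _ = 0
      rw [hB]
      fin_cases i <;> fin_cases j <;>
        simp [heJ, hen, heD, hJe, hJn, hJD, hne, hnJ, hnD, G.symm x D] at hij ⊢
    · intro i hi
      change B _ _ = 0 at hi
      rw [hB] at hi
      fin_cases i <;> simp at hi
      · exact hee.ne' hi
      · exact hee.ne' (hJJ.symm.trans hi)
      · exact one_ne_zero (hnn.symm.trans hi)
      · exact (G.pos x D hD0).ne' hi
  have hcard := hli.fintype_card_le_finrank
  have : Module.finrank ℝ (TangentSpace I x) = 3 := hdim
  rw [this] at hcard
  simp at hcard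

omit [I.Boundaryless] in
/-- In dimension three, `dα` and `⟨J·, ·⟩` restrict to proportional forms on the plane `ξ`. -/
lemma extDerivOne_eq_mul (hdim : Module.finrank ℝ E = 3) {x : M} {e : TangentSpace I x}
    (he : α x e = 0) (he1 : G.inner x e e = 1) (v w : TangentSpace I x) :
    extDerivOne I α x v w = extDerivOne I α x e (J x e) * G.inner x (J x v) w := by
  have hα := h.formDifferentiableAt x
  have hexp : ∀ v : TangentSpace I x, contactPart I G.inner R x v
      = G.inner x e v • e + G.inner x (J x e) v • J x e := by
    intro v
    have h1 := h.inner_self_smul hdim he v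
    rw [he1, one_smul, one_mul, h.inner_unitReeb] at h1
    have h2 := h.contactPart_add_unitReeb x v
    exact add_right_cancel (h2.trans h1)
  have hz : ∀ c : ℝ, ∀ u v w : TangentSpace I x, extDerivOne I α x (u + c • v) w
      = extDerivOne I α x u w + c * extDerivOne I α x v w := fun c u v w =>
    extDerivOne_add_smul_left hα u v w c
  have h0 : ∀ w, extDerivOne I α x 0 w = 0 := fun w => by
    have := hz (-1) w w w
    rw [neg_one_smul, add_neg_cancel] at this
    linarith
  have hs : ∀ (c : ℝ) (v w : TangentSpace I x), extDerivOne I α x (c • v) w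
      = c * extDerivOne I α x v w := fun c v w => by
    have := hz c 0 v w
    rwa [zero_add, h0, zero_add] at this
  have hl : ∀ v w, extDerivOne I α x (contactPart I G.inner R x v) w =
      G.inner x e v * extDerivOne I α x e w
        + G.inner x (J x e) v * extDerivOne I α x (J x e) w := fun v w => by
    rw [hexp v, hz, hs]
  have hr : ∀ v w, extDerivOne I α x w (contactPart I G.inner R x v) =
      G.inner x e v * extDerivOne I α x w e
        + G.inner x (J x e) v * extDerivOne I α x w (J x e) := fun v w => by
    rw [extDerivOne_swap, hl, extDerivOne_swap α x e, extDerivOne_swap α x (J x e)]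
    ring
  rw [← h.extDerivOne_contactPart, hl, hr, hr, extDerivOne_self, extDerivOne_self,
    extDerivOne_swap α x (J x e) e]
  have hJv : G.inner x (J x v) w = G.inner x e v * G.inner x (J x e) w
      - G.inner x (J x e) v * G.inner x e w := by
    rw [← h.complex_contactPart, hexp v, map_add, map_smul, map_smul, h.complex.sq x e he]
    simp only [map_add, map_smul, map_neg, add_apply, smul_apply, neg_apply, smul_eq_mul]
    ring
  rw [hJv]
  ring

/-- The chosen oriented orthonormal basis of `ξ_x` is of the form `(e, J e)`. -/
lemma contactFrame_spec (hdim : Module.finrank ℝ E = 3) (x : M) :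
    α x (contactFrame I G.inner α x).1 = 0 ∧
      G.inner x (contactFrame I G.inner α x).1 (contactFrame I G.inner α x).1 = 1 ∧
      (contactFrame I G.inner α x).2 = J x (contactFrame I G.inner α x).1 := by
  obtain ⟨e, he, he1⟩ := exists_unit_mem_ker (G := G) (α := α) hdim x
  have hpos : ∀ e : TangentSpace I x, α x e = 0 → G.inner x e e = 1 →
      0 < extDerivOne I α x e (J x e) := fun e he he1 => h.complex.pos x e he (by
    rintro rfl; simp at he1)
  have hspec := Classical.epsilon_spec (p := fun e : TangentSpace I x × TangentSpace I x =>
    α x e.1 = 0 ∧ α x e.2 = 0 ∧ G.inner x e.1 e.1 = 1 ∧ G.inner x e.2 e.2 = 1 ∧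
      G.inner x e.1 e.2 = 0 ∧ 0 < extDerivOne I α x e.1 e.2)
    ⟨(e, J x e), he, h.complex.mem x e, he1, (h.isometric x e e he he).trans he1,
      by rw [G.symm, h.inner_complex_self], hpos e he he1⟩
  change α x (contactFrame I G.inner α x).1 = 0 ∧ α x (contactFrame I G.inner α x).2 = 0 ∧
    G.inner x (contactFrame I G.inner α x).1 (contactFrame I G.inner α x).1 = 1 ∧
    G.inner x (contactFrame I G.inner α x).2 (contactFrame I G.inner α x).2 = 1 ∧
    G.inner x (contactFrame I G.inner α x).1 (contactFrame I G.inner α x).2 = 0 ∧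
    0 < extDerivOne I α x (contactFrame I G.inner α x).1 (contactFrame I G.inner α x).2 at hspec
  obtain ⟨h1, h2, h11, h22, h12, hω⟩ := hspec
  generalize (contactFrame I G.inner α x).1 = e₁ at *
  generalize (contactFrame I G.inner α x).2 = e₂ at *
  refine ⟨h1, h11, ?_⟩
  have hexp := h.inner_self_smul hdim h1 e₂
  rw [h11, one_smul, h12, zero_smul, zero_add, h.inner_unitReeb_of_mem h2, mul_zero, zero_smul,
    add_zero] at hexp
  rw [h.extDerivOne_eq_mul hdim h1 h11] at hω
  have hc := pos_of_mul_pos_right hω (hpos e₁ h1 h11).le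
  set c := G.inner x (J x e₁) e₂ with hcdef
  have hc2 : c * c = 1 := by
    rw [← h22]
    conv_rhs => rw [hexp]
    rw [map_smul, map_smul, smul_apply, h.isometric x _ _ h1 h1, h11]
    simp
  have : c = 1 := by nlinarith
  rw [hexp, this, one_smul]

lemma contactRotation_eq (hdim : Module.finrank ℝ E = 3) (x : M) :
    contactRotation I G.inner α R x = reebNorm I G.inner R x *
      extDerivOne I α x (contactFrame I G.inner α x).1 (J x (contactFrame I G.inner α x).1) := by
  obtain ⟨h1, h11, h2⟩ := h.contactFrame_spec hdim x
  rw [contactRotation, h2]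
  generalize (contactFrame I G.inner α x).1 = e at *
  have hX : ∀ u : TangentSpace I x, α x u = 0 → contactExtend I G.inner R u x = u := fun u hu => by
    simp only [contactExtend, extend_apply_self, h.contactPart_of_mem hu]
  have hXd : ∀ u : TangentSpace I x, MDiffAt (T% (contactExtend I G.inner R u)) x := fun u =>
    (h.contMDiffAt_contactExtend u).mdifferentiableAt (by simp)
  have := extDerivOne_eq (h.formDifferentiableAt x) (hXd e) (hXd (J x e))
  have hα0 : ∀ u : TangentSpace I x, (fun y => α y (contactExtend I G.inner R u y)) = fun _ => 0 :=
    fun u => funext fun y => h.apply_contactPart y _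
  rw [hα0, hα0, hX e h1, hX _ (h.complex.mem x e)] at this
  rw [this, G.symm, h.inner_unitReeb]
  simp [mvfderiv_const]

/-- In dimension three `dα = (θ' / ρ) ⟨J·, ·⟩`. -/
lemma extDerivOne_eq_contactRotation (hdim : Module.finrank ℝ E = 3) (x : M)
    (v w : TangentSpace I x) :
    extDerivOne I α x v w =
      contactRotation I G.inner α R x / reebNorm I G.inner R x * G.inner x (J x v) w := by
  obtain ⟨h1, h11, -⟩ := h.contactFrame_spec hdim x
  rw [h.contactRotation_eq hdim, mul_div_cancel_left₀ _ (h.reebNorm_pos x).ne',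
    ← h.extDerivOne_eq_mul hdim h1 h11]

lemma contactRotation_pos (hdim : Module.finrank ℝ E = 3) (x : M) :
    0 < contactRotation I G.inner α R x := by
  obtain ⟨h1, h11, -⟩ := h.contactFrame_spec hdim x
  rw [h.contactRotation_eq hdim]
  exact mul_pos (h.reebNorm_pos x) (h.complex.pos x _ h1 (by
    intro h0; rw [h0] at h11; simp at h11))

/-- The frame that defines `θ'` may vary discontinuously, but near `x` one has
`θ' / ρ = -α([X, J X]) / ‖X‖²` for any smooth local section `X ≠ 0` of `ξ`. -/
lemma mdifferentiableAt_contactRotation_div (hdim : Module.finrank ℝ E = 3) (x : M) :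
    MDiffAt (fun y => contactRotation I G.inner α R y / reebNorm I G.inner R y) x := by
  have : IsManifold I (minSmoothness ℝ 2) M := by
    rw [minSmoothness_of_isRCLikeNormedField]; infer_instance
  have : IsManifold I (((2 : ℕ∞) : ℕ∞ω) + 1) M := IsManifold.of_le (n := ∞) (mod_cast le_top)
  have h2 : (2 : ℕ∞ω) ≤ ∞ := WithTop.coe_le_coe.2 le_top
  obtain ⟨e, he, he1⟩ := exists_unit_mem_ker (G := G) (α := α) hdim x
  set X := contactExtend I G.inner R e with hXdef
  have hX : CMDiffAt ∞ (T% X) x := h.contMDiffAt_contactExtend e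
  have hXx : X x = e := by
    simp only [hXdef, contactExtend, extend_apply_self, h.contactPart_of_mem he]
  have hα0 : ∀ y, α y (X y) = 0 := fun y => h.apply_contactPart y _
  have hbr : MDiffAt (T% (mlieBracket I X (fun y => J y (X y)))) x :=
    (ContMDiffAt.mlieBracket_vectorField (m := 1) (n := 2) (hX.of_le h2)
      (h.contMDiffAt_complex h2 (hX.of_le h2)) (by simp; norm_num)).mdifferentiableAt (by simp)
  have hXd : MDiffAt (T% X) x := hX.mdifferentiableAt (by simp)
  have hXX := metricDifferentiableAt G x _ _ hXd hXd
  have hne : G.inner x (X x) (X x) ≠ 0 := by rw [hXx, he1]; exact one_ne_zero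
  have hev : ∀ᶠ y in nhds x, contactRotation I G.inner α R y / reebNorm I G.inner R y =
      -α y (mlieBracket I X (fun y => J y (X y)) y) * (G.inner y (X y) (X y))⁻¹ := by
    filter_upwards [hXX.continuousAt.eventually_ne hne,
      (contMDiffAt_iff_contMDiffAt_nhds (by simp)).1 (hX.of_le h2)] with y hy hXy
    have hXyd : MDiffAt (T% X) y := hXy.mdifferentiableAt (by simp)
    have h1 := extDerivOne_eq (h.formDifferentiableAt y) hXyd (h.mdifferentiableAt_complex hXyd)
    simp only [hα0, h.complex.mem, mvfderiv_const, zero_apply] at h1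
    rw [h.extDerivOne_eq_contactRotation hdim, h.isometric y _ _ (hα0 y) (hα0 y)] at h1
    rw [eq_mul_inv_iff_mul_eq₀ hy, h1]
    ring
  have hd : MDiffAt (fun y => -α y (mlieBracket I X (fun y => J y (X y)) y)
      * (G.inner y (X y) (X y))⁻¹) x :=
    MDifferentiableAt.mul (h.formDifferentiableAt x _ hbr).neg 
      (((ContMDiffAt.metric_apply (metric_contMDiff G x) hX hX).inv₀ hne).mdifferentiableAt
        (by simp))
  exact hd.congr_of_eventuallyEq hev

end IsWeaklyCompatible

end Proportional

/-! ### Mean curvature and the Levi form in dimension three -/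

section ThreeDim

variable {E : Type*} [NormedAddCommGroup E] [NormedSpace ℝ E] [FiniteDimensional ℝ E]
  {H : Type*} [TopologicalSpace H] {I : ModelWithCorners ℝ E H} [I.Boundaryless]
  {M : Type*} [TopologicalSpace M] [ChartedSpace H M] [IsManifold I ∞ M]
  {G : ContMDiffRiemannianMetric I ∞ E (fun x : M => TangentSpace I x)}
  {α : Π x : M, TangentSpace I x →L[ℝ] ℝ} {R : Π x : M, TangentSpace I x}
  {J : Π x : M, TangentSpace I x →L[ℝ] TangentSpace I x} {f : M → ℝ}

namespace IsWeaklyCompatible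

variable (h : IsWeaklyCompatible I G.inner α R J)
include h

omit [I.Boundaryless] in
lemma secondFundamentalForm_self {x : M} (u : TangentSpace I x) :
    secondFundamentalForm I G.inner R x u u = (1 / 2) * koszul I G.inner
      (contactExtend I G.inner R u) (contactExtend I G.inner R u) (unitReeb I G.inner R) x := by
  have hX : MDiffAt (T% (contactExtend I G.inner R u)) x :=
    (h.contMDiffAt_contactExtend u).mdifferentiableAt (by simp)
  have hn : MDiffAt (T% (unitReeb I G.inner R)) x :=
    (h.contMDiff_unitReeb x).mdifferentiableAt (by simp)
  rw [secondFundamentalForm, ← two_mul_leviCivita (metricDifferentiableAt G x) G.symm (G.pos x)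
    hX hX hn]
  simp only [map_add, add_apply]
  ring

omit [I.Boundaryless] in
/-- The value `⟨∇_X X, n⟩` for a section `X` of `ξ` depends only on `X` at the point. -/
lemma koszul_unitReeb_congr {x : M} {X Y : Π y : M, TangentSpace I y}
    (hX : MDiffAt (T% X) x) (hY : MDiffAt (T% Y) x) (hX0 : ∀ y, α y (X y) = 0)
    (hY0 : ∀ y, α y (Y y) = 0) (hXY : X x = Y x) :
    koszul I G.inner X X (unitReeb I G.inner R) x
      = koszul I G.inner Y Y (unitReeb I G.inner R) x := by
  have hn : MDiffAt (T% (unitReeb I G.inner R)) x :=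
    (h.contMDiff_unitReeb x).mdifferentiableAt (by simp)
  have hη : FormDifferentiableAt I (fun y => G.inner y (unitReeb I G.inner R y)) x := fun Z hZ =>
    metricDifferentiableAt G x _ _ hn hZ
  have := covDerivForm_congr (metricDifferentiableAt G x) G.symm hη hn (fun v => rfl)
    hX hY hX hY hXY hXY
  simp only [covDerivForm, h.inner_unitReeb, hX0, hY0, mul_zero, mvfderiv_const, zero_apply] at this
  linarith

/-- The trace of the second fundamental form is the logarithmic derivative of `θ' / ρ` along `n`:
this is `koszul_add_koszul_eq` for `a = b = 0` and `Z = n`. -/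
lemma two_mul_meanCurvature (hdim : Module.finrank ℝ E = 3) (x : M) :
    2 * meanCurvature I G.inner α R x =
      (contactRotation I G.inner α R x / reebNorm I G.inner R x)⁻¹ *
        mvfderiv I (fun y => contactRotation I G.inner α R y / reebNorm I G.inner R y) x
          (unitReeb I G.inner R x) := by
  have h2 : (2 : ℕ∞ω) ≤ ∞ := WithTop.coe_le_coe.2 le_top
  obtain ⟨h1, h11, he2⟩ := h.contactFrame_spec hdim x
  rw [meanCurvature, he2, h.secondFundamentalForm_self, h.secondFundamentalForm_self]
  generalize (contactFrame I G.inner α x).1 = e at *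
  have hn : CMDiffAt 2 (T% (unitReeb I G.inner R)) x := (h.contMDiff_unitReeb x).of_le h2
  have hXd : ∀ u : TangentSpace I x, CMDiffAt 2 (T% (contactExtend I G.inner R u)) x := fun u =>
    (h.contMDiffAt_contactExtend u).of_le h2
  have hX0 : ∀ (u : TangentSpace I x) y, α y (contactExtend I G.inner R u y) = 0 := fun u y =>
    h.apply_contactPart y _
  have hXx : ∀ u : TangentSpace I x, α x u = 0 → contactExtend I G.inner R u x = u := fun u hu => by
    simp only [contactExtend, extend_apply_self, h.contactPart_of_mem hu]
  have hμ := (h.contactRotation_pos hdim x).ne'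
  have hK := h.koszul_add_koszul_eq (x := x)
    (Filter.Eventually.of_forall fun y => h.extDerivOne_eq_contactRotation hdim y)
    (h.mdifferentiableAt_contactRotation_div hdim x)
    (div_ne_zero hμ (h.reebNorm_pos x).ne') 0 0 (hX0 e) (hXd e) hn
    (U := contactExtend I G.inner R e) (P := fun y => J y (contactExtend I G.inner R e y))
    (by simp) (by simp)
  rw [h.koszul_unitReeb_congr ((hXd (J x e)).mdifferentiableAt (by simp))
    (h.mdifferentiableAt_complex ((hXd e).mdifferentiableAt (by simp))) (hX0 _)
    (fun y => h.complex.mem y _) (by rw [hXx _ (h.complex.mem x e), hXx e h1])]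
  have hJn : ∀ w, G.inner x (J x w) (unitReeb I G.inner R x) = 0 := fun w => by
    rw [G.symm, h.inner_unitReeb_of_mem (h.complex.mem x w)]
  have hen : G.inner x e (unitReeb I G.inner R x) = 0 := by
    rw [G.symm, h.inner_unitReeb_of_mem h1]
  rw [hJn, hJn, hXx e h1, hen, h11] at hK
  rw [← mul_assoc]
  ring_nf at hK ⊢
  exact hK

/-- The Levi form in dimension three; the frame `e, J e, n` makes the correction a multiple of
`‖v‖²`. -/
lemma leviForm_eq_of_finrank_eq_three (hdim : Module.finrank ℝ E = 3) (hf : CMDiff ∞ f)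
    {w : Symplectization M} {v : TangentSpace (𝓘(ℝ, ℝ).prod I) w}
    (hv : v ∈ complexTangencies I G.inner α R J f w) {μ : M → ℝ}
    (hμ : ∀ᶠ y in nhds w.2, ∀ v w, extDerivOne I α y v w = μ y * G.inner y (J y v) w)
    (hμd : MDiffAt μ w.2) (hμ0 : μ w.2 ≠ 0) :
    leviForm I G.inner α R J f w v v =
      sympHessian I G.inner f w v v
      + sympHessian I G.inner f w (sympJ I G.inner α R J w v) (sympJ I G.inner α R J w v)
      - ((reebNorm I G.inner R w.2)⁻¹
            * mvfderiv I (reebNorm I G.inner R) w.2 (riemGradient I G.inner f w.2)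
          - ((reebNorm I G.inner R w.2)⁻¹
              * mvfderiv I (reebNorm I G.inner R) w.2 (unitReeb I G.inner R w.2)
            + (μ w.2)⁻¹ * mvfderiv I μ w.2 (unitReeb I G.inner R w.2))
            * mvfderiv I f w.2 (unitReeb I G.inner R w.2))
        * sympNorm I G.inner w v ^ 2 := by
  obtain ⟨hu, hp⟩ := mvfderiv_eq_zero_of_mem_complexTangencies h hf hv
  rw [leviForm_eq_hessian_add h hf hv hμ hμd hμ0 _ _ rfl rfl, sympNorm_sq]
  rw [projM_sympJ] at hp ⊢
  set b := dtForm I w v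
  set u := projM I w v
  set z := riemGradient I G.inner f w.2
  set n := unitReeb I G.inner R w.2
  have hue := h.contactPart_add_unitReeb w.2 u
  have hαe := h.apply_contactPart w.2 u
  rw [← h.complex_contactPart w.2 u] at hp ⊢
  set e := contactPart I G.inner R w.2 u
  set a := reebNorm I G.inner R w.2 * α w.2 u
  have huu : G.inner w.2 u u = G.inner w.2 e e + a ^ 2 := by
    rw [← hue]
    simp only [map_add, map_smul, add_apply, smul_apply, smul_eq_mul]
    rw [h.inner_unitReeb_self, G.symm w.2 e (unitReeb I G.inner R w.2),
      h.inner_unitReeb_of_mem hαe]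
    ring
  have hdual : ∀ w', G.inner w.2 w' z = mvfderiv I f w.2 w' := fun w' => by
    rw [G.symm]; exact inner_riemGradient G f w.2 w'
  have hfr := h.inner_self_smul hdim hαe z
  rw [hdual, hdual, hdual] at hfr
  rw [← hue, map_add, map_smul, smul_eq_mul] at hu
  rw [map_add, map_smul, smul_eq_mul] at hp
  have hτ := congrArg (mvfderiv I (reebNorm I G.inner R) w.2) hfr
  have hl := congrArg (mvfderiv I μ w.2) hfr
  have hτu := congrArg (mvfderiv I (reebNorm I G.inner R) w.2) hue
  have hlu := congrArg (mvfderiv I μ w.2) hue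
  simp only [map_add, map_smul, smul_eq_mul] at hτ hl hτu hlu ⊢
  rw [huu, ← hτu, ← hlu]
  have hu' : mvfderiv I f w.2 e = -(a * mvfderiv I f w.2 n) := by linarith
  have hp' : mvfderiv I f w.2 (J w.2 e) = -(b * mvfderiv I f w.2 n) := by linarith
  rw [hu', hp'] at hτ hl
  -- `df(e) = -a df(n)` and `df(J e) = -b df(n)` turn the expansion of `∇f` into the claim.
  linear_combination (μ w.2)⁻¹ * hl + (reebNorm I G.inner R w.2)⁻¹ * hτ

end IsWeaklyCompatible

/-- For a CR-compatible metric structure `ρ` and `μ = θ'` are constant, so there is no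
correction. -/
lemma IsCRCompatible.leviForm_eq (h : IsCRCompatible I G.inner α R J) (hf : CMDiff ∞ f)
    {w : Symplectization M} {v : TangentSpace (𝓘(ℝ, ℝ).prod I) w}
    (hv : v ∈ complexTangencies I G.inner α R J f w) :
    leviForm I G.inner α R J f w v v =
      sympHessian I G.inner f w v v
      + sympHessian I G.inner f w (sympJ I G.inner α R J w v) (sympJ I G.inner α R J w v) := by
  have h' := h.isWeaklyCompatible
  obtain ⟨θ, hθ0, hθ⟩ := h.metric
  have hμ : ∀ y v w, extDerivOne I α y v w = θ * G.inner y (J y v) w := by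
    intro y v w
    rw [← h'.extDerivOne_contactPart, ← h'.inner_complex_contactPart,
      hθ y _ _ (h.complex.mem y _) (h'.apply_contactPart y w),
      h.complex.invariant y _ _ (h'.apply_contactPart y v) (h'.apply_contactPart y w),
      mul_inv_cancel_left₀ hθ0.ne']
  have hρ : reebNorm I G.inner R = fun _ => 1 := funext fun y => by
    rw [reebNorm, gNorm, h.unit, Real.sqrt_one]
  rw [leviForm_eq_hessian_add h' hf hv (μ := fun _ => θ) (Filter.Eventually.of_forall hμ)
    mdifferentiableAt_const hθ0.ne' _ _ rfl rfl, hρ]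
  simp [mvfderiv_const]

end ThreeDim

/-! ### Levi form and Riemannian Hessian -/

theorem mainTheorem11 {E : Type*} [NormedAddCommGroup E] [NormedSpace ℝ E] [FiniteDimensional ℝ E]
    {M : Type*} [TopologicalSpace M] [T2Space M] [ChartedSpace E M] [IsManifold 𝓘(ℝ, E) ∞ M]
    (n : ℕ) (hdim : Module.finrank ℝ E = 2 * n + 1)
    (g : ContMDiffRiemannianMetric 𝓘(ℝ, E) ∞ E (fun x : M => TangentSpace 𝓘(ℝ, E) x))
    (α : Π x : M, TangentSpace 𝓘(ℝ, E) x →L[ℝ] ℝ)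
    (R : Π x : M, TangentSpace 𝓘(ℝ, E) x)
    (J : Π x : M, TangentSpace 𝓘(ℝ, E) x →L[ℝ] TangentSpace 𝓘(ℝ, E) x)
    (f : M → ℝ) (hf : ContMDiff 𝓘(ℝ, E) 𝓘(ℝ, ℝ) ∞ f)
    (c : ℝ) (hc : ∀ x : M, f x = c → mvfderiv 𝓘(ℝ, E) f x ≠ 0) :
    (IsCRCompatible 𝓘(ℝ, E) g.inner α R J →
      ∀ w ∈ sympHypersurface f c, ∀ v ∈ complexTangencies 𝓘(ℝ, E) g.inner α R J f w,
        leviForm 𝓘(ℝ, E) g.inner α R J f w v v =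
          sympHessian 𝓘(ℝ, E) g.inner f w v v
            + sympHessian 𝓘(ℝ, E) g.inner f w
                (sympJ 𝓘(ℝ, E) g.inner α R J w v) (sympJ 𝓘(ℝ, E) g.inner α R J w v)) ∧
    (n = 1 → IsWeaklyCompatible 𝓘(ℝ, E) g.inner α R J →
      ∀ w ∈ sympHypersurface f c, ∀ v ∈ complexTangencies 𝓘(ℝ, E) g.inner α R J f w,
        leviForm 𝓘(ℝ, E) g.inner α R J f w v v =
          sympHessian 𝓘(ℝ, E) g.inner f w v v
            + sympHessian 𝓘(ℝ, E) g.inner f w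
                (sympJ 𝓘(ℝ, E) g.inner α R J w v) (sympJ 𝓘(ℝ, E) g.inner α R J w v)
            - gNorm 𝓘(ℝ, E) g.inner w.2 (riemGradient 𝓘(ℝ, E) g.inner f w.2)
              * g.inner w.2 (levelNormal 𝓘(ℝ, E) g.inner f w.2)
                  (contactPart 𝓘(ℝ, E) g.inner R w.2
                      (riemGradient 𝓘(ℝ, E) g.inner
                        (fun x => Real.log (reebNorm 𝓘(ℝ, E) g.inner R x)) w.2)
                    - (2 * meanCurvature 𝓘(ℝ, E) g.inner α R w.2)
                      • unitReeb 𝓘(ℝ, E) g.inner R w.2)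
              * sympNorm 𝓘(ℝ, E) g.inner w v ^ 2 ∧
        leviForm 𝓘(ℝ, E) g.inner α R J f w v v =
          sympHessian 𝓘(ℝ, E) g.inner f w v v
            + sympHessian 𝓘(ℝ, E) g.inner f w
                (sympJ 𝓘(ℝ, E) g.inner α R J w v) (sympJ 𝓘(ℝ, E) g.inner α R J w v)
            - gNorm 𝓘(ℝ, E) g.inner w.2 (riemGradient 𝓘(ℝ, E) g.inner f w.2)
              * g.inner w.2 (levelNormal 𝓘(ℝ, E) g.inner f w.2)
                  (riemGradient 𝓘(ℝ, E) g.inner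
                      (fun x => Real.log (reebNorm 𝓘(ℝ, E) g.inner R x)) w.2
                    - normalPart 𝓘(ℝ, E) g.inner R w.2
                      (riemGradient 𝓘(ℝ, E) g.inner
                        (fun x => Real.log (contactRotation 𝓘(ℝ, E) g.inner α R x)) w.2))
              * sympNorm 𝓘(ℝ, E) g.inner w v ^ 2) := by
  refine ⟨fun h w _ v hv => h.leviForm_eq hf hv, fun hn h w _ v hv => ?_⟩
  have hdim3 : Module.finrank ℝ E = 3 := by rw [hdim, hn]
  have hρ := h.reebNorm_pos w.2
  have hθ := h.contactRotation_pos hdim3 w.2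
  have hρd : MDiffAt (reebNorm 𝓘(ℝ, E) g.inner R) w.2 :=
    (h.contMDiff_reebNorm w.2).mdifferentiableAt (by simp)
  have hμd := h.mdifferentiableAt_contactRotation_div hdim3 w.2
  have hprod : contactRotation 𝓘(ℝ, E) g.inner α R = fun y =>
      contactRotation 𝓘(ℝ, E) g.inner α R y / reebNorm 𝓘(ℝ, E) g.inner R y
        * reebNorm 𝓘(ℝ, E) g.inner R y :=
    funext fun y => (div_mul_cancel₀ _ (h.reebNorm_pos y).ne').symm
  have hθd : MDiffAt (contactRotation 𝓘(ℝ, E) g.inner α R) w.2 := by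
    rw [hprod]; exact MDifferentiableAt.mul hμd hρd
  -- `d ln θ'(n) = d ln ρ(n) + 2H`, which also makes the two forms of the correction agree.
  have hdθ : (contactRotation 𝓘(ℝ, E) g.inner α R w.2)⁻¹
        * mvfderiv 𝓘(ℝ, E) (contactRotation 𝓘(ℝ, E) g.inner α R) w.2
          (unitReeb 𝓘(ℝ, E) g.inner R w.2)
      = (reebNorm 𝓘(ℝ, E) g.inner R w.2)⁻¹ * mvfderiv 𝓘(ℝ, E) (reebNorm 𝓘(ℝ, E) g.inner R) w.2
          (unitReeb 𝓘(ℝ, E) g.inner R w.2)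
        + 2 * meanCurvature 𝓘(ℝ, E) g.inner α R w.2 := by
    have h1 := mvfderiv_mul_apply hμd hρd (unitReeb 𝓘(ℝ, E) g.inner R w.2)
    rw [← hprod] at h1
    rw [h.two_mul_meanCurvature hdim3, h1]
    field_simp
  have hL := h.leviForm_eq_of_finrank_eq_three hdim3 hf hv
    (Filter.Eventually.of_forall fun y => h.extDerivOne_eq_contactRotation hdim3 y) hμd
    (div_ne_zero hθ.ne' hρ.ne')
  rw [← h.two_mul_meanCurvature hdim3] at hL
  have hnormal : ∀ w', mvfderiv 𝓘(ℝ, E) f w.2 (normalPart 𝓘(ℝ, E) g.inner R w.2 w')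
      = g.inner w.2 w' (unitReeb 𝓘(ℝ, E) g.inner R w.2)
        * mvfderiv 𝓘(ℝ, E) f w.2 (unitReeb 𝓘(ℝ, E) g.inner R w.2) := fun w' => by
    rw [normalPart, map_smul, smul_eq_mul]
  have hgrad : ∀ F : M → ℝ, mvfderiv 𝓘(ℝ, E) f w.2 (riemGradient 𝓘(ℝ, E) g.inner F w.2)
      = mvfderiv 𝓘(ℝ, E) F w.2 (riemGradient 𝓘(ℝ, E) g.inner f w.2) := fun F => by
    rw [← inner_riemGradient g f, g.symm, inner_riemGradient]
  rw [gNorm_mul_inner_levelNormal, gNorm_mul_inner_levelNormal, hL]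
  simp only [contactPart, map_sub, map_smul, smul_eq_mul, hnormal, hgrad, inner_riemGradient,
    mvfderiv_log hρd hρ.ne', mvfderiv_log hθd hθ.ne', hdθ, and_true]
  ring

end
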